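/- Let $d\in\{1,2,3\}$, let $\omega_1,\dots,\omega_d>0$, put $\Omega(x)=\sum_{j=1}^d\omega_j^2x_j^2$ on $\mathbb{R}^d$ and $A=-\Delta+\Omega$. Let $\varphi_n(t)=(2^n\,n!\,\sqrt{\pi})^{-1/2}H_n(t)e^{-t^2/2}$ be the normalised Hermite functions, where $H_n$ is the $n$-th (physicists') Hermite polynomial, and for $\mathbf{k}\in\mathbb{N}_0^d$ let $$\varphi_{\mathbf{k}}(x)=\prod_{j=1}^d\omega_j^{1/4}\varphi_{k_j}(\sqrt{\omega_j}\,x_j),\qquad \lambda_{\mathbf{k}}=\sum_{j=1}^d\omega_j(2k_j+1)$$ be the $L^2$-normalised eigenfunctions and the eigenvalues of $A$. Let $\tilde H^2(\mathbb{R}^d)$ be the linear space of all $u\in L^2(\mathbb{R}^d;\mathbb{C})$ for which $$\|u\|_{\tilde H^2}^2=\sum_{\mathbf{k}\in\mathbb{N}_0^d}\lambda_{\mathbf{k}}^2\,|\langle\varphi_{\mathbf{k}},u\rangle_{L^2}|^2$$ is finite. Then $\tilde H^2(\mathbb{R}^d)=D(A)$, the set of all $u\in L^2(\mathbb{R}^d;\mathbb{C})$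 such that the tempered distribution $Au=-\Delta u+\Omega u$ belongs to $L^2$, with $\|u\|_{\tilde H^2}=\|Au\|_{L^2}$ for all $u\in D(A)$; and $\tilde H^2(\mathbb{R}^d)$ is an algebra with the pointwise product: there is a constant $C>0$, depending only on $d$ and $\omega_1,\dots,\omega_d$, such that for all $u,v\in\tilde H^2(\mathbb{R}^d)$ one has $uv\in\tilde H^2(\mathbb{R}^d)$ and $$\|uv\|_{\tilde H^2}\le C\,\|u\|_{\tilde H^2}\,\|v\|_{\tilde H^2}.$$ -/

import Mathlib

open MeasureTheory TemperedDistribution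
open scoped SchwartzMap Laplacian

/-- The `n`-th `L²(ℝ)`-normalised Hermite function `(2ⁿ n! √π)^{-1/2} Hₙ(x) e^{-x²/2}`. The
polynomials `Polynomial.hermite n` are the probabilists' ones, and `Hₙ(x) = 2^{n/2} Heₙ(√2 x)`. -/
noncomputable def hermiteFunction (n : ℕ) (x : ℝ) : ℝ :=
  (√((n.factorial : ℝ) * √Real.pi))⁻¹ *
    (Polynomial.aeval (√2 * x) (Polynomial.hermite n) * Real.exp (-(x ^ 2) / 2))

/-- The quadratic form `Ω(x) = ω₁² x₁² + ⋯ + ω_d² x_d²`. -/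
noncomputable def trapPotential {d : ℕ} (ω : Fin d → ℝ) (x : EuclideanSpace ℝ (Fin d)) : ℝ :=
  ∑ j, ω j ^ 2 * x j ^ 2

/-- The eigenvalue `λ_k = ∑ⱼ ωⱼ (2 kⱼ + 1)` of `-Δ + Ω`. -/
noncomputable def oscillatorEigenvalue {d : ℕ} (ω : Fin d → ℝ) (k : Fin d → ℕ) : ℝ :=
  ∑ j, ω j * (2 * (k j : ℝ) + 1)

/-- The normalised eigenfunction `φ_k(x) = ∏ⱼ ωⱼ^{1/4} φ_{kⱼ}(√ωⱼ xⱼ)` of `-Δ + Ω`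
(for `ωⱼ > 0`). -/
noncomputable def oscillatorEigenfunction {d : ℕ} (ω : Fin d → ℝ) (k : Fin d → ℕ)
    (x : EuclideanSpace ℝ (Fin d)) : ℝ :=
  ∏ j, ω j ^ (1 / 4 : ℝ) * hermiteFunction (k j) (√(ω j) * x j)

theorem continuous_hermiteFunction (n : ℕ) : Continuous (hermiteFunction n) := by
  unfold hermiteFunction
  fun_prop

theorem continuous_oscillatorEigenfunction {d : ℕ} (ω : Fin d → ℝ) (k : Fin d → ℕ) :
    Continuous (oscillatorEigenfunction ω k) := by
  have := continuous_hermiteFunction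
  unfold oscillatorEigenfunction
  fun_prop

theorem integrable_aeval_mul_exp_neg_sq (p : Polynomial ℝ) :
    Integrable (fun x : ℝ => p.eval x * Real.exp (-(x ^ 2))) := by
  induction p using Polynomial.induction_on' with
  | add p q hp hq =>
    refine (hp.add hq).congr (Filter.Eventually.of_forall fun x => ?_)
    simp [add_mul]
  | monomial n a =>
    have h := (integrable_rpow_mul_exp_neg_mul_sq (b := 1) one_pos
      (s := n) (by linarith [n.cast_nonneg (α := ℝ)])).const_mul a
    simpa [mul_assoc] using h

theorem integrable_hermiteFunction_sq (n : ℕ) :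
    Integrable (fun x : ℝ => hermiteFunction n x ^ 2) := by
  set c := (√((n.factorial : ℝ) * √Real.pi))⁻¹
  set q : Polynomial ℝ := ((Polynomial.hermite n).map (Int.castRingHom ℝ)).comp
    (Polynomial.C √2 * Polynomial.X)
  have h := (integrable_aeval_mul_exp_neg_sq (q ^ 2)).const_mul (c ^ 2)
  refine h.congr (Filter.Eventually.of_forall fun x => ?_)
  have e : Real.exp (-(x ^ 2)) = Real.exp (-(x ^ 2) / 2) ^ 2 := by
    rw [← Real.exp_nat_mul]; congr 1; push_cast; ring
  have hq : q.eval x = Polynomial.aeval (√2 * x) (Polynomial.hermite n) := by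
    simp [q, Polynomial.aeval_def, Polynomial.eval_map]
  simp only [hermiteFunction, Polynomial.eval_pow, hq, e]
  ring

theorem memLp_oscillatorEigenfunction {d : ℕ} {ω : Fin d → ℝ} (hω : ∀ j, 0 < ω j)
    (k : Fin d → ℕ) :
    MemLp (fun x => (oscillatorEigenfunction ω k x : ℂ)) 2 volume := by
  refine MemLp.ofReal (f := oscillatorEigenfunction ω k) ?_
  rw [memLp_two_iff_integrable_sq (continuous_oscillatorEigenfunction ω k).aestronglyMeasurable]
  have h : Integrable (fun x : Fin d → ℝ =>
      ∏ j, (ω j ^ (1 / 4 : ℝ)) ^ 2 * hermiteFunction (k j) (√(ω j) * x j) ^ 2) := by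
    refine Integrable.fintype_prod
      (f := fun j y => (ω j ^ (1 / 4 : ℝ)) ^ 2 * hermiteFunction (k j) (√(ω j) * y) ^ 2)
      fun j => Integrable.const_mul ?_ _
    exact (integrable_hermiteFunction_sq (k j)).comp_mul_left' (Real.sqrt_pos.2 (hω j)).ne'
  have h2 := (PiLp.volume_preserving_ofLp (Fin d)).integrable_comp_of_integrable h
  refine h2.congr (Filter.Eventually.of_forall fun x => ?_)
  simp [oscillatorEigenfunction, ← Finset.prod_pow, mul_pow]

/-- The eigenfunction `φ_k` as an element of `L²(ℝᵈ; ℂ)`. -/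
noncomputable def oscillatorEigenvector {d : ℕ} {ω : Fin d → ℝ} (hω : ∀ j, 0 < ω j)
    (k : Fin d → ℕ) : Lp ℂ 2 (volume : Measure (EuclideanSpace ℝ (Fin d))) :=
  (memLp_oscillatorEigenfunction hω k).toLp _

/-- The terms `λ_k^s |⟨φ_k, u⟩_{L²}|²` of the series that defines `‖u‖²` in `H̃ˢ(ℝᵈ)`. -/
noncomputable def hermiteSobolevTerm {d : ℕ} {ω : Fin d → ℝ} (hω : ∀ j, 0 < ω j) (s : ℝ)
    (u : Lp ℂ 2 (volume : Measure (EuclideanSpace ℝ (Fin d)))) (k : Fin d → ℕ) : ℝ :=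
  oscillatorEigenvalue ω k ^ s * ‖inner ℂ (oscillatorEigenvector hω k) u‖ ^ 2

theorem oscillatorEigenvalue_nonneg {d : ℕ} {ω : Fin d → ℝ} (hω : ∀ j, 0 < ω j)
    (k : Fin d → ℕ) : 0 ≤ oscillatorEigenvalue ω k :=
  Finset.sum_nonneg fun j _ => mul_nonneg (hω j).le (by positivity)

/-- The space `H̃ˢ(ℝᵈ) = D(A^{s/2})`, `A = -Δ + Ω`: all `u ∈ L²(ℝᵈ; ℂ)` for which
`∑_k λ_k^s |⟨φ_k, u⟩|²` is finite. -/
noncomputable def hermiteSobolev {d : ℕ} {ω : Fin d → ℝ} (hω : ∀ j, 0 < ω j) (s : ℝ) :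
    Submodule ℂ (Lp ℂ 2 (volume : Measure (EuclideanSpace ℝ (Fin d)))) where
  carrier := {u | Summable (hermiteSobolevTerm hω s u)}
  zero_mem' := by
    have h : hermiteSobolevTerm hω s 0 = 0 := by
      ext k
      simp [hermiteSobolevTerm]
    rw [Set.mem_ofPred_eq, h]
    exact summable_zero
  add_mem' := by
    intro u v hu hv
    refine Summable.of_nonneg_of_le (fun k => ?_) (fun k => ?_) ((hu.add hv).mul_left 2)
    · exact mul_nonneg (Real.rpow_nonneg (oscillatorEigenvalue_nonneg hω k) s) (sq_nonneg _)
    · have hk := Real.rpow_nonneg (oscillatorEigenvalue_nonneg hω k) s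
      simp only [hermiteSobolevTerm, inner_add_right]
      set a := inner ℂ (oscillatorEigenvector hω k) u
      set b := inner ℂ (oscillatorEigenvector hω k) v
      have h1 : ‖a + b‖ ^ 2 ≤ 2 * (‖a‖ ^ 2 + ‖b‖ ^ 2) := by
        have := norm_add_le a b
        nlinarith [sq_nonneg (‖a‖ - ‖b‖), norm_nonneg (a + b)]
      nlinarith [mul_le_mul_of_nonneg_left h1 hk]
  smul_mem' := by
    intro c u hu
    refine (Summable.mul_left (‖c‖ ^ 2) hu).congr fun k => ?_
    simp only [hermiteSobolevTerm, inner_smul_right, norm_mul]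
    ring

/-- The norm `‖u‖ = (∑_k λ_k^s |⟨φ_k, u⟩|²)^{1/2}` of `H̃ˢ(ℝᵈ)`; meaningful on
`hermiteSobolev hω s`. -/
noncomputable def hermiteSobolevNorm {d : ℕ} {ω : Fin d → ℝ} (hω : ∀ j, 0 < ω j) (s : ℝ)
    (u : Lp ℂ 2 (volume : Measure (EuclideanSpace ℝ (Fin d)))) : ℝ :=
  √(∑' k, hermiteSobolevTerm hω s u k)

/-- The potential has temperate growth, so that multiplication by it (below) is the genuine
multiplication of tempered distributions. -/
theorem hasTemperateGrowth_trapPotential {d : ℕ} (ω : Fin d → ℝ) :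
    (fun x : EuclideanSpace ℝ (Fin d) => (trapPotential ω x : ℂ)).HasTemperateGrowth := by
  have hj : ∀ j : Fin d,
      (fun x : EuclideanSpace ℝ (Fin d) => x j).HasTemperateGrowth := fun j =>
    (EuclideanSpace.proj (𝕜 := ℝ) j).hasTemperateGrowth
  have h : (fun x : EuclideanSpace ℝ (Fin d) => trapPotential ω x).HasTemperateGrowth := by
    unfold trapPotential
    fun_prop
  fun_prop

/-- The harmonic oscillator `A = -Δ + Ω` on tempered distributions on `ℝᵈ`. -/
noncomputable def harmonicOscillator {d : ℕ} (ω : Fin d → ℝ)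
    (T : 𝓢'(EuclideanSpace ℝ (Fin d), ℂ)) : 𝓢'(EuclideanSpace ℝ (Fin d), ℂ) :=
  -Δ T + smulLeftCLM ℂ (fun x => (trapPotential ω x : ℂ)) T

/-- `u ∈ D(A)` with `Au = f`, for the realisation of `A = -Δ + Ω` in `L²(ℝᵈ; ℂ)` whose domain
consists of all `u ∈ L²` such that the distribution `-Δu + Ωu` belongs to `L²`. -/
def IsHarmonicOscillatorValue {d : ℕ} (ω : Fin d → ℝ)
    (u f : Lp ℂ 2 (volume : Measure (EuclideanSpace ℝ (Fin d)))) : Prop :=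
  harmonicOscillator ω (Lp.toTemperedDistribution u) = Lp.toTemperedDistribution f

/-! The algebra property rests on an a priori bound for Schwartz functions, `‖A(fg)‖ ≤ C ‖Af‖ ‖Ag‖`
in `L²` (`exists_norm_toL2_oscillator_pmul_le`). Expand `A(fg) = -(Δf)g - fΔg - 2∇f·∇g + (Ωf)g`. The
graph norm of `A` controls `Δf` and `Ωf` separately (`norm_toL2_laplacian_sq_add_le`), because
integration by parts bounds the cross term `Re⟨Δf, Ωf⟩` above by a multiple of `‖f‖²`. For `d ≤ 3`
it then controls the supremum norm as well (`exists_norm_apply_le`). This settles every term but the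
gradient one, where Cauchy–Schwarz and a Gagliardo–Nirenberg inequality
(`norm_toL2_pmul_lineDerivOp_self_le`) bound the `L⁴` norm of a derivative by the supremum norm and
the second derivative.

The description of `D(A)` is spectral. The `φ_k` are Schwartz eigenfunctions and form a Hilbert
basis (`oscillatorBasis`). For completeness, if `g` is orthogonal to all of them, then `e^{-q} g`
with `q = ∑ ωⱼ xⱼ²/2` integrates to zero against products of one-variable polynomials. Expanding the
exponential shows that its Fourier transform vanishes, so `g = 0`. Hence `Au = f` holds exactly when
the coefficients satisfy `⟨φ_k, f⟩ = λ_k ⟨φ_k, u⟩` (`isHarmonicOscillatorValue_iff_inner`), and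
Parseval gives the domain and its norm.

Partial sums of the eigenfunction expansion are Schwartz and converge in the graph norm, so the a
priori bound passes to products of arbitrary elements of `D(A)`. -/

open scoped LineDeriv FourierTransform InnerProductSpace

/-! ### `L²`, Gagliardo–Nirenberg and Sobolev estimates for Schwartz functions. -/

namespace SchwartzMap

section Estimates

set_option linter.unusedSectionVars false

variable {E : Type*} [NormedAddCommGroup E] [InnerProductSpace ℝ E] [FiniteDimensional ℝ E]
  [MeasurableSpace E] [BorelSpace E]

/-- The embedding of the Schwartz space into `L²`. -/
noncomputable abbrev toL2 : 𝓢(E, ℂ) →L[ℂ] Lp ℂ 2 (volume : Measure E) :=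
  toLpCLM ℂ ℂ 2 volume

/-- The pointwise product of Schwartz functions. -/
noncomputable def pmul (f g : 𝓢(E, ℂ)) : 𝓢(E, ℂ) := pairing (ContinuousLinearMap.mul ℂ ℂ) f g

/-- The pointwise complex conjugate of a Schwartz function. -/
noncomputable def conj (f : 𝓢(E, ℂ)) : 𝓢(E, ℂ) :=
  postcompCLM (Complex.conjCLE : ℂ →L[ℝ] ℂ) f

@[simp] theorem pmul_apply (f g : 𝓢(E, ℂ)) (x : E) : pmul f g x = f x * g x := rfl

@[simp] theorem conj_apply (f : 𝓢(E, ℂ)) (x : E) : conj f x = starRingEnd ℂ (f x) := rfl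

theorem lineDerivOp_pmul (f g : 𝓢(E, ℂ)) (v : E) :
    ∂_{v} (pmul f g) = pmul (∂_{v} f) g + pmul f (∂_{v} g) := by
  ext x
  have h := ((f.hasFDerivAt x).mul (g.hasFDerivAt x)).fderiv
  change fderiv ℝ (fun y => f y * g y) x v = fderiv ℝ f x v * g x + f x * fderiv ℝ g x v
  rw [show (fun y => f y * g y) = ⇑f * ⇑g from rfl, h]
  simp
  ring

theorem lineDerivOp_conj (f : 𝓢(E, ℂ)) (v : E) : ∂_{v} (conj f) = conj (∂_{v} f) := by
  ext x
  have h := ((Complex.conjCLE : ℂ →L[ℝ] ℂ).hasFDerivAt.comp x (f.hasFDerivAt x)).fderiv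
  change fderiv ℝ (fun y => (Complex.conjCLE : ℂ →L[ℝ] ℂ) (f y)) x v = _
  erw [h]
  rfl

theorem lineDerivOp_smulLeftCLM {g : E → ℂ} (hg : g.HasTemperateGrowth) (f : 𝓢(E, ℂ)) (v x : E) :
    ∂_{v} (smulLeftCLM ℂ g f) x = fderiv ℝ g x v * f x + g x * ∂_{v} f x := by
  have hd : DifferentiableAt ℝ g x := (hg.1.differentiable (by simp)) x
  have h := (hd.hasFDerivAt.mul (f.hasFDerivAt x)).fderiv
  rw [lineDerivOp_apply_eq_fderiv, lineDerivOp_apply_eq_fderiv]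
  have e : (smulLeftCLM ℂ g f : E → ℂ) = g * ⇑f := by
    ext y; simp [smulLeftCLM_apply_apply hg]
  rw [e, h]
  simp
  ring

theorem coeFn_toL2 (f : 𝓢(E, ℂ)) : toL2 f =ᵐ[volume] f := f.coeFn_toLp 2 volume

theorem norm_toL2_sq (f : 𝓢(E, ℂ)) : ‖toL2 f‖ ^ 2 = ∫ x, ‖f x‖ ^ 2 := by
  have h := norm_toLp' (f := f) (p := 2) (μ := volume) (by simp) (by simp)
  rw [toLpCLM_apply, h, ← Real.rpow_natCast, ← Real.rpow_mul (by positivity)]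
  simp

theorem norm_toL2 (f : 𝓢(E, ℂ)) : ‖toL2 f‖ = √(∫ x, ‖f x‖ ^ 2) := by
  rw [← norm_toL2_sq, Real.sqrt_sq (norm_nonneg _)]

theorem norm_toL2_le_mul {f g : 𝓢(E, ℂ)} {c : ℝ} (h : ∀ x, ‖f x‖ ≤ c * ‖g x‖) :
    ‖toL2 f‖ ≤ c * ‖toL2 g‖ := by
  refine Lp.norm_le_mul_norm_of_ae_le_mul ?_
  filter_upwards [coeFn_toL2 f, coeFn_toL2 g] with x h1 h2
  rw [h1, h2]
  exact h x

theorem real_inner_toL2 (f g : 𝓢(E, ℂ)) :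
    ⟪toL2 f, toL2 g⟫_ℝ = ∫ x, ⟪f x, g x⟫_ℝ := by
  rw [L2.inner_def]
  refine integral_congr_ae ?_
  filter_upwards [coeFn_toL2 f, coeFn_toL2 g] with x h1 h2
  rw [h1, h2]

theorem integral_norm_mul_norm_le (f g : 𝓢(E, ℂ)) :
    ∫ x, ‖f x‖ * ‖g x‖ ≤ ‖toL2 f‖ * ‖toL2 g‖ := by
  have h := integral_mul_norm_le_Lp_mul_Lq (μ := (volume : Measure E)) (f := f) (g := g)
    Real.HolderConjugate.two_two
    (by simpa using f.memLp 2 volume) (by simpa using g.memLp 2 volume)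
  rw [norm_toL2, norm_toL2, Real.sqrt_eq_rpow, Real.sqrt_eq_rpow]
  simpa using h

/-- Integration by parts in `L²`. -/
theorem real_inner_toL2_lineDerivOp (f g : 𝓢(E, ℂ)) (v : E) :
    ⟪toL2 (∂_{v} f), toL2 g⟫_ℝ = -⟪toL2 f, toL2 (∂_{v} g)⟫_ℝ := by
  rw [real_inner_toL2, real_inner_toL2]
  have h : ∫ x, ⟪f x, ∂_{v} g x⟫_ℝ = -∫ x, ⟪∂_{v} f x, g x⟫_ℝ :=
    integral_bilinear_lineDerivOp_right_eq_neg_left (μ := volume) f g (innerSL ℝ) v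
  rw [h, neg_neg]

/-- Up to a constant, directional derivatives are Fourier multipliers, and multipliers commute. -/
theorem lineDerivOp_comm (f : 𝓢(E, ℂ)) (v w : E) : ∂_{v} (∂_{w} f) = ∂_{w} (∂_{v} f) := by
  have hv : (inner ℝ · v : E → ℝ).HasTemperateGrowth := by fun_prop
  have hw : (inner ℝ · w : E → ℝ).HasTemperateGrowth := by fun_prop
  rw [lineDeriv_eq_fourierMultiplierCLM w f, LineDeriv.lineDerivOp_smul,
    lineDeriv_eq_fourierMultiplierCLM v (fourierMultiplierCLM ℂ _ f),
    lineDeriv_eq_fourierMultiplierCLM v f, LineDeriv.lineDerivOp_smul,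
    lineDeriv_eq_fourierMultiplierCLM w (fourierMultiplierCLM ℂ _ f),
    fourierMultiplierCLM_fourierMultiplierCLM_apply hv hw,
    fourierMultiplierCLM_fourierMultiplierCLM_apply hw hv,
    mul_comm (fun x : E => ⟪x, v⟫_ℝ)]

/-- Two integrations by parts turn `⟨∂ᵢ∂ᵢf, ∂ₖ∂ₖf⟩` into `‖∂ᵢ∂ₖf‖²`, so `‖Δf‖²` is the sum of the
squared norms of all second derivatives. -/
theorem norm_toL2_lineDerivOp_lineDerivOp_le {ι : Type*} [Fintype ι] (b : OrthonormalBasis ι ℝ E)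
    (f : 𝓢(E, ℂ)) (j : ι) : ‖toL2 (∂_{b j} (∂_{b j} f))‖ ≤ ‖toL2 (Δ f)‖ := by
  have h : ‖toL2 (Δ f)‖ ^ 2 = ∑ i, ∑ k, ‖toL2 (∂_{b i} (∂_{b k} f))‖ ^ 2 := by
    rw [← real_inner_self_eq_norm_sq, laplacian_eq_sum b, map_sum, sum_inner]
    refine Finset.sum_congr rfl fun i _ => ?_
    rw [inner_sum]
    refine Finset.sum_congr rfl fun k _ => ?_
    rw [real_inner_toL2_lineDerivOp, lineDerivOp_comm _ (b i) (b k), ← real_inner_toL2_lineDerivOp,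
      lineDerivOp_comm _ (b i) (b k), real_inner_self_eq_norm_sq]
  have h2 : ‖toL2 (∂_{b j} (∂_{b j} f))‖ ^ 2 ≤ ‖toL2 (Δ f)‖ ^ 2 := by
    rw [h]
    set N : ι → ι → ℝ := fun i k => ‖toL2 (∂_{b i} (∂_{b k} f))‖ ^ 2 with hN
    have hN0 : ∀ i k, 0 ≤ N i k := fun i k => sq_nonneg _
    calc N j j ≤ ∑ k, N j k :=
          Finset.single_le_sum (f := N j) (fun i _ => hN0 j i) (Finset.mem_univ j)
      _ ≤ ∑ i, ∑ k, N i k := Finset.single_le_sum (f := fun i => ∑ k, N i k)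
          (fun i _ => Finset.sum_nonneg fun k _ => hN0 i k) (Finset.mem_univ j)
  exact (sq_le_sq₀ (norm_nonneg _) (norm_nonneg _)).1 h2

/-- The Gagliardo–Nirenberg inequality `‖∂f‖²_{L⁴} ≤ 3 ‖f‖_{L^∞} ‖∂²f‖_{L²}`. -/
theorem norm_toL2_pmul_lineDerivOp_self_le (f : 𝓢(E, ℂ)) (v : E) {M : ℝ} (hM : ∀ x, ‖f x‖ ≤ M) :
    ‖toL2 (pmul (∂_{v} f) (∂_{v} f))‖ ≤ 3 * M * ‖toL2 (∂_{v} (∂_{v} f))‖ := by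
  have hM0 : 0 ≤ M := (norm_nonneg _).trans (hM 0)
  set p := ∂_{v} f with hp
  set q := ∂_{v} p with hq
  set s := pmul p p with hs
  -- Both sides are `∫ |p|⁴`; isolating one factor `p = ∂f` lets the derivative be moved off `f`.
  have h1 : ‖toL2 s‖ ^ 2 = ⟪toL2 p, toL2 (pmul s (conj p))⟫_ℝ := by
    rw [real_inner_toL2, norm_toL2_sq]
    congr 1 with x
    have e : p x * p x * starRingEnd ℂ (p x) * starRingEnd ℂ (p x) = ((‖p x‖ ^ 4 : ℝ) : ℂ) := by
      rw [show p x * p x * starRingEnd ℂ (p x) * starRingEnd ℂ (p x) =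
        (p x * starRingEnd ℂ (p x)) ^ 2 by ring, Complex.mul_conj, Complex.normSq_eq_norm_sq]
      push_cast
      ring
    simp only [hs, pmul_apply, conj_apply, norm_mul, Complex.inner]
    rw [e, Complex.ofReal_re]
    ring
  have h2 : ‖toL2 s‖ ^ 2 ≤ 3 * M * (‖toL2 s‖ * ‖toL2 q‖) := by
    rw [h1, hp, real_inner_toL2_lineDerivOp, real_inner_toL2, ← integral_neg]
    refine le_trans ?_ (mul_le_mul_of_nonneg_left (integral_norm_mul_norm_le s q)
      (by positivity))
    rw [← integral_const_mul]
    have hsq : Integrable (fun x => 3 * M * (‖s x‖ * ‖q x‖)) := by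
      simpa using ((pmul s q).integrable (μ := volume)).norm.const_mul (3 * M)
    refine (Real.le_norm_self _).trans (norm_integral_le_of_norm_le hsq (ae_of_all _ fun x => ?_))
    -- The constant 3 counts the factors of `p · p · p̄` that the derivative can hit.
    have hd : ‖∂_{v} (pmul s (conj p)) x‖ ≤ 3 * (‖s x‖ * ‖q x‖) := by
      rw [lineDerivOp_pmul, hs, lineDerivOp_pmul, lineDerivOp_conj, ← hq]
      simp only [add_apply, pmul_apply, conj_apply]
      refine (norm_add_le _ _).trans ?_
      rw [show q x * p x + p x * q x = 2 * (q x * p x) by ring]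
      simp only [norm_mul, RCLike.norm_conj, Complex.norm_ofNat]
      linarith
    rw [norm_neg, Real.norm_eq_abs]
    calc _ ≤ ‖f x‖ * ‖∂_{v} (pmul s (conj p)) x‖ := abs_real_inner_le_norm _ _
      _ ≤ M * (3 * (‖s x‖ * ‖q x‖)) := mul_le_mul (hM x) hd (norm_nonneg _) hM0
      _ = _ := by ring
  rcases (norm_nonneg (toL2 s)).eq_or_lt with h0 | h0
  · rw [← h0]; positivity
  · nlinarith

/-- Cauchy–Schwarz for `|f|²` and `|g|²`; it reduces the mixed products `∂f ∂g` to the squares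
treated by Gagliardo–Nirenberg. -/
theorem norm_toL2_pmul_le_sqrt (f g : 𝓢(E, ℂ)) :
    ‖toL2 (pmul f g)‖ ^ 2 ≤ ‖toL2 (pmul f f)‖ * ‖toL2 (pmul g g)‖ := by
  refine le_trans (le_of_eq ?_) (integral_norm_mul_norm_le _ _)
  rw [norm_toL2_sq]
  congr 1 with x
  simp
  ring

theorem fourier_laplacian_apply (f : 𝓢(E, ℂ)) (ξ : E) :
    𝓕 (Δ f) ξ = -(2 * Real.pi) ^ 2 * ‖ξ‖ ^ 2 * 𝓕 f ξ := by
  have h : ((‖·‖ ^ 2 : E → ℝ)).HasTemperateGrowth := Function.hasTemperateGrowth_norm_sq E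
  rw [laplacian_eq_fourierMultiplierCLM, fourierMultiplierCLM_apply,
    ← Complex.coe_smul, FourierTransform.fourier_smul, FourierTransform.fourier_fourierInv_eq,
    smul_apply, smulLeftCLM_apply_apply h]
  simp
  ring

/-- The Sobolev embedding `H² ⊆ L^∞` in dimension at most three. -/
theorem exists_norm_apply_le (hE : Module.finrank ℝ E ≤ 3) :
    ∃ K : ℝ, 0 ≤ K ∧ ∀ (f : 𝓢(E, ℂ)) (x : E), ‖f x‖ ≤ K * (‖toL2 f‖ + ‖toL2 (Δ f)‖) := by
  -- The square of this weight decays like `‖ξ‖⁻⁴`, which is integrable because the dimension is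
  -- below 4.
  set w : E → ℝ := fun ξ => (1 + ‖ξ‖ ^ 2)⁻¹ with hw
  have hwc : Continuous w := by
    rw [hw]
    exact Continuous.inv₀ (by fun_prop) fun ξ => by positivity
  have hw2 : MemLp w 2 (volume : Measure E) := by
    rw [memLp_two_iff_integrable_sq hwc.aestronglyMeasurable]
    have h := integrable_rpow_neg_one_add_norm_sq (E := E) (μ := volume) (r := 4)
      (lt_of_le_of_lt (Nat.cast_le.2 hE) (by norm_num))
    refine h.congr (ae_of_all _ fun ξ => ?_)
    have h0 : 0 ≤ 1 + ‖ξ‖ ^ 2 := by positivity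
    change (1 + ‖ξ‖ ^ 2) ^ (-4 / 2 : ℝ) = ((1 + ‖ξ‖ ^ 2)⁻¹) ^ 2
    rw [show (-4 / 2 : ℝ) = -(2 : ℕ) by norm_num, Real.rpow_neg h0, Real.rpow_natCast, inv_pow]
  refine ⟨√(∫ ξ, w ξ ^ 2), Real.sqrt_nonneg _, fun f x => ?_⟩
  -- Chosen so that `𝓕 g = (1 + ‖ξ‖²) 𝓕 f`; Cauchy–Schwarz then bounds the `L¹` norm of `𝓕 f = w 𝓕
  -- g`, and Plancherel returns to `g`.
  set g : 𝓢(E, ℂ) := f - ((2 * Real.pi) ^ 2 : ℂ)⁻¹ • Δ f with hg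
  have hgf : ∀ ξ, ‖𝓕 f ξ‖ = ‖w ξ‖ * ‖𝓕 g ξ‖ := by
    intro ξ
    have hp : (2 * Real.pi : ℂ) ^ 2 ≠ 0 := by simp [Real.pi_ne_zero]
    have e : 𝓕 g ξ = (1 + ‖ξ‖ ^ 2 : ℝ) * 𝓕 f ξ := by
      rw [hg, sub_eq_add_neg, ← neg_smul, FourierTransform.fourier_add,
        FourierTransform.fourier_smul, add_apply, smul_apply,
        fourier_laplacian_apply, smul_eq_mul]
      push_cast
      field_simp
    rw [e, norm_mul, Complex.norm_real, hw, Real.norm_of_nonneg (by positivity),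
      Real.norm_of_nonneg (by positivity), ← mul_assoc, inv_mul_cancel₀ (by positivity), one_mul]
  have h1 : ‖f x‖ ≤ ∫ ξ, ‖𝓕 f ξ‖ := by
    -- By Fourier inversion, `f x` is the Fourier transform of `𝓕 f` at `-x`.
    have h := norm_fourier_apply_le_toLp_one (𝓕 f) (-x)
    rw [norm_toLp_one] at h
    refine le_trans (le_of_eq ?_) h
    have e : 𝓕⁻ (𝓕 f) = f := FourierTransform.fourierInv_fourier_eq f
    conv_lhs => rw [← e]
    rfl
  have h2 : ∫ ξ, ‖𝓕 f ξ‖ ≤ √(∫ ξ, w ξ ^ 2) * ‖toL2 (𝓕 g)‖ := by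
    have h := fun G : 𝓢(E, ℂ) => integral_mul_norm_le_Lp_mul_Lq (μ := (volume : Measure E))
      (f := w) (g := fun ξ => ‖G ξ‖) Real.HolderConjugate.two_two (by simpa using hw2)
      (by simpa using (G.memLp 2 volume).norm)
    rw [norm_toL2, Real.sqrt_eq_rpow, Real.sqrt_eq_rpow]
    simp only [hgf]
    simpa using h (𝓕 g)
  have h3 : ‖toL2 (𝓕 g)‖ ≤ ‖toL2 f‖ + ‖toL2 (Δ f)‖ := by
    have e : ‖toL2 (𝓕 g)‖ = ‖toL2 g‖ := norm_fourier_toL2_eq g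
    rw [e, hg, map_sub, map_smul]
    refine (norm_sub_le _ _).trans ?_
    rw [norm_smul]
    have hpi : ‖((2 * Real.pi) ^ 2 : ℂ)⁻¹‖ ≤ 1 := by
      rw [norm_inv, norm_pow, norm_mul, Complex.norm_real, Real.norm_of_nonneg Real.pi_pos.le,
        Complex.norm_ofNat]
      exact inv_le_one_of_one_le₀ (by nlinarith [Real.pi_gt_three])
    nlinarith [norm_nonneg (toL2 (Δ f))]
  exact h1.trans (h2.trans (mul_le_mul_of_nonneg_left h3 (Real.sqrt_nonneg _)))

end Estimates

end SchwartzMap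

/-! ### The harmonic oscillator on Schwartz functions and its product estimate. -/

namespace SchwartzMap

section Oscillator

variable {d : ℕ}

/-- The harmonic oscillator `-Δ + Ω` on Schwartz functions. -/
noncomputable def oscillator (ω : Fin d → ℝ) :
    𝓢(EuclideanSpace ℝ (Fin d), ℂ) →L[ℂ] 𝓢(EuclideanSpace ℝ (Fin d), ℂ) :=
  -LineDeriv.laplacianCLM ℂ (EuclideanSpace ℝ (Fin d)) 𝓢(EuclideanSpace ℝ (Fin d), ℂ) +
    smulLeftCLM ℂ (fun x => (trapPotential ω x : ℂ))

theorem oscillator_eq (ω : Fin d → ℝ) (f : 𝓢(EuclideanSpace ℝ (Fin d), ℂ)) :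
    oscillator ω f = -Δ f + smulLeftCLM ℂ (fun x => (trapPotential ω x : ℂ)) f := by
  simp [oscillator]

theorem hasTemperateGrowth_coord (j : Fin d) :
    (fun x : EuclideanSpace ℝ (Fin d) => (x j : ℂ)).HasTemperateGrowth := by
  have hj : (fun x : EuclideanSpace ℝ (Fin d) => x j).HasTemperateGrowth :=
    (EuclideanSpace.proj (𝕜 := ℝ) j).hasTemperateGrowth
  fun_prop

/-- Multiplication of Schwartz functions by the `j`-th coordinate. -/
noncomputable abbrev mulCoord (j : Fin d) (f : 𝓢(EuclideanSpace ℝ (Fin d), ℂ)) :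
    𝓢(EuclideanSpace ℝ (Fin d), ℂ) :=
  smulLeftCLM ℂ (fun x => (x j : ℂ)) f

theorem mulCoord_apply (j : Fin d) (f : 𝓢(EuclideanSpace ℝ (Fin d), ℂ))
    (x : EuclideanSpace ℝ (Fin d)) : mulCoord j f x = x j * f x := by
  rw [smulLeftCLM_apply_apply (hasTemperateGrowth_coord j), smul_eq_mul]

theorem smulLeftCLM_trapPotential_apply (ω : Fin d → ℝ) (f : 𝓢(EuclideanSpace ℝ (Fin d), ℂ))
    (x : EuclideanSpace ℝ (Fin d)) :
    smulLeftCLM ℂ (fun x => (trapPotential ω x : ℂ)) f x = trapPotential ω x * f x := by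
  rw [smulLeftCLM_apply_apply (hasTemperateGrowth_trapPotential ω), smul_eq_mul]

theorem lineDerivOp_mulCoord (j : Fin d) (f : 𝓢(EuclideanSpace ℝ (Fin d), ℂ)) :
    ∂_{EuclideanSpace.basisFun (Fin d) ℝ j} (mulCoord j f) =
      f + mulCoord j (∂_{EuclideanSpace.basisFun (Fin d) ℝ j} f) := by
  ext x
  have h : HasFDerivAt (fun x : EuclideanSpace ℝ (Fin d) => (x j : ℂ))
      (Complex.ofRealCLM.comp (EuclideanSpace.proj (𝕜 := ℝ) j)) x :=
    (Complex.ofRealCLM.comp (EuclideanSpace.proj (𝕜 := ℝ) j)).hasFDerivAt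
  rw [lineDerivOp_smulLeftCLM (hasTemperateGrowth_coord j), h.fderiv, add_apply, mulCoord_apply]
  simp

theorem lineDerivOp_smulLeftCLM_trapPotential (ω : Fin d → ℝ) (j : Fin d)
    (f : 𝓢(EuclideanSpace ℝ (Fin d), ℂ)) :
    ∂_{EuclideanSpace.basisFun (Fin d) ℝ j}
        (smulLeftCLM ℂ (fun x => (trapPotential ω x : ℂ)) f) =
      smulLeftCLM ℂ (fun x => (trapPotential ω x : ℂ))
        (∂_{EuclideanSpace.basisFun (Fin d) ℝ j} f) + (2 * ω j ^ 2) • mulCoord j f := by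
  ext x
  have h : HasFDerivAt (fun x : EuclideanSpace ℝ (Fin d) => (trapPotential ω x : ℂ))
      (Complex.ofRealCLM.comp (∑ i, ω i ^ 2 • ((2 * x i) • EuclideanSpace.proj (𝕜 := ℝ) i))) x := by
    have h0 : HasFDerivAt (fun x : EuclideanSpace ℝ (Fin d) => ∑ j, ω j ^ 2 * x j ^ 2)
        (∑ i, ω i ^ 2 • ((2 * x i) • EuclideanSpace.proj (𝕜 := ℝ) i)) x := by
      refine HasFDerivAt.fun_sum fun i _ => HasFDerivAt.const_mul ?_ _
      simpa using ((EuclideanSpace.proj (𝕜 := ℝ) i).hasFDerivAt (x := x)).pow 2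
    exact Complex.ofRealCLM.hasFDerivAt.comp x h0
  rw [lineDerivOp_smulLeftCLM (hasTemperateGrowth_trapPotential ω), h.fderiv, add_apply,
    smul_apply, mulCoord_apply, smulLeftCLM_trapPotential_apply]
  simp
  ring

/-- Integrating by parts reproduces the same inner product with the opposite sign, plus `‖f‖²` from
the commutator `[∂ⱼ, xⱼ] = 1`. -/
theorem real_inner_toL2_lineDerivOp_mulCoord (j : Fin d) (f : 𝓢(EuclideanSpace ℝ (Fin d), ℂ)) :
    2 * ⟪toL2 (∂_{EuclideanSpace.basisFun (Fin d) ℝ j} f), toL2 (mulCoord j f)⟫_ℝ =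
      -‖toL2 f‖ ^ 2 := by
  have h1 := real_inner_toL2_lineDerivOp f (mulCoord j f) (EuclideanSpace.basisFun (Fin d) ℝ j)
  have h2 : ⟪toL2 f, toL2 (mulCoord j (∂_{EuclideanSpace.basisFun (Fin d) ℝ j} f))⟫_ℝ =
      ⟪toL2 (∂_{EuclideanSpace.basisFun (Fin d) ℝ j} f), toL2 (mulCoord j f)⟫_ℝ := by
    rw [real_inner_toL2, real_inner_toL2]
    congr 1 with x
    simp only [mulCoord_apply, Complex.inner]
    simp
    ring
  rw [lineDerivOp_mulCoord, map_add, inner_add_right, real_inner_self_eq_norm_sq, h2] at h1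
  linarith

theorem real_inner_toL2_smul_right (f g : 𝓢(EuclideanSpace ℝ (Fin d), ℂ)) (r : ℝ) :
    ⟪toL2 f, toL2 (r • g)⟫_ℝ = r * ⟪toL2 f, toL2 g⟫_ℝ := by
  rw [real_inner_toL2, real_inner_toL2, ← integral_const_mul]
  congr 1 with x
  rw [smul_apply, real_inner_smul_right]

theorem real_inner_toL2_smulLeftCLM_trapPotential_nonneg (ω : Fin d → ℝ)
    (f : 𝓢(EuclideanSpace ℝ (Fin d), ℂ)) :
    0 ≤ ⟪toL2 f, toL2 (smulLeftCLM ℂ (fun x => (trapPotential ω x : ℂ)) f)⟫_ℝ := by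
  rw [real_inner_toL2]
  refine integral_nonneg fun x => ?_
  have h0 : 0 ≤ trapPotential ω x := Finset.sum_nonneg fun j _ => by positivity
  change 0 ≤ ⟪f x, smulLeftCLM ℂ (fun x => (trapPotential ω x : ℂ)) f x⟫_ℝ
  rw [smulLeftCLM_trapPotential_apply, ← smul_eq_mul, Complex.coe_smul, real_inner_smul_right,
    real_inner_self_eq_norm_sq]
  positivity

/-- The graph norm of the oscillator controls `Δ` and `Ω` separately. -/
theorem norm_toL2_laplacian_sq_add_le (ω : Fin d → ℝ) (f : 𝓢(EuclideanSpace ℝ (Fin d), ℂ)) :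
    ‖toL2 (Δ f)‖ ^ 2 + ‖toL2 (smulLeftCLM ℂ (fun x => (trapPotential ω x : ℂ)) f)‖ ^ 2 ≤
      ‖toL2 (oscillator ω f)‖ ^ 2 + 2 * (∑ j, ω j ^ 2) * ‖toL2 f‖ ^ 2 := by
  set Q := smulLeftCLM ℂ (fun x : EuclideanSpace ℝ (Fin d) => (trapPotential ω x : ℂ)) with hQ
  -- Integration by parts in each direction gives `-⟨∂ⱼf, Ω∂ⱼf⟩ ≤ 0` and `-2ωⱼ²⟨∂ⱼf, xⱼf⟩ =
  -- ωⱼ²‖f‖²`.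
  have h : ⟪toL2 (Δ f), toL2 (Q f)⟫_ℝ ≤ (∑ j, ω j ^ 2) * ‖toL2 f‖ ^ 2 := by
    rw [laplacian_eq_sum (EuclideanSpace.basisFun (Fin d) ℝ), map_sum, sum_inner, Finset.sum_mul]
    refine Finset.sum_le_sum fun j _ => ?_
    have h1 := real_inner_toL2_lineDerivOp_mulCoord j f
    have h2 := real_inner_toL2_smulLeftCLM_trapPotential_nonneg ω
      (∂_{EuclideanSpace.basisFun (Fin d) ℝ j} f)
    rw [real_inner_toL2_lineDerivOp, lineDerivOp_smulLeftCLM_trapPotential, map_add,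
      inner_add_right, real_inner_toL2_smul_right]
    nlinarith
  have e : ‖toL2 (oscillator ω f)‖ ^ 2 =
      ‖toL2 (Q f)‖ ^ 2 - 2 * ⟪toL2 (Q f), toL2 (Δ f)⟫_ℝ + ‖toL2 (Δ f)‖ ^ 2 := by
    rw [oscillator_eq, neg_add_eq_sub, map_sub, norm_sub_sq_real]
  rw [e, real_inner_comm]
  linarith

theorem laplacian_pmul (f g : 𝓢(EuclideanSpace ℝ (Fin d), ℂ)) :
    Δ (pmul f g) = pmul (Δ f) g + pmul f (Δ g) +
      (2 : ℂ) • ∑ j, pmul (∂_{EuclideanSpace.basisFun (Fin d) ℝ j} f)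
        (∂_{EuclideanSpace.basisFun (Fin d) ℝ j} g) := by
  simp only [laplacian_eq_sum (EuclideanSpace.basisFun (Fin d) ℝ), lineDerivOp_pmul,
    LineDeriv.lineDerivOp_add]
  ext x
  simp only [sum_apply, add_apply, pmul_apply, smul_apply, Finset.sum_mul, Finset.mul_sum,
    smul_eq_mul, ← Finset.sum_add_distrib]
  refine Finset.sum_congr rfl fun j _ => ?_
  ring

/-- If `-Δ + Ω` is bounded below, its graph norm controls `Δ`, `Ω` and the supremum norm. -/
theorem exists_norm_le_mul_norm_toL2_oscillator (hd : d ≤ 3) (ω : Fin d → ℝ) {c : ℝ} (hc0 : 0 ≤ c)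
    (hc : ∀ f : 𝓢(EuclideanSpace ℝ (Fin d), ℂ), ‖toL2 f‖ ≤ c * ‖toL2 (oscillator ω f)‖) :
    ∃ κ M : ℝ, 0 ≤ κ ∧ 0 ≤ M ∧ ∀ f : 𝓢(EuclideanSpace ℝ (Fin d), ℂ),
      ‖toL2 (Δ f)‖ ≤ κ * ‖toL2 (oscillator ω f)‖ ∧
      ‖toL2 (smulLeftCLM ℂ (fun x => (trapPotential ω x : ℂ)) f)‖ ≤
        κ * ‖toL2 (oscillator ω f)‖ ∧
      ∀ x, ‖f x‖ ≤ M * ‖toL2 (oscillator ω f)‖ := by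
  obtain ⟨K, hK0, hK⟩ := exists_norm_apply_le (E := EuclideanSpace ℝ (Fin d)) (by simpa using hd)
  set S := ∑ j, ω j ^ 2 with hS
  have hS0 : 0 ≤ S := Finset.sum_nonneg fun j _ => sq_nonneg _
  -- Inserting `‖f‖ ≤ c ‖Af‖` into the graph estimate produces the factor `1 + 2Sc²` on the squares.
  set κ := √(1 + 2 * S * c ^ 2) with hκ
  have hκ0 : 0 ≤ κ := Real.sqrt_nonneg _
  have hκ2 : κ ^ 2 = 1 + 2 * S * c ^ 2 := Real.sq_sqrt (by positivity)
  set Q := smulLeftCLM ℂ (fun x : EuclideanSpace ℝ (Fin d) => (trapPotential ω x : ℂ)) with hQ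
  have hgraph : ∀ f, ‖toL2 (Δ f)‖ ^ 2 + ‖toL2 (Q f)‖ ^ 2 ≤
      (κ * ‖toL2 (oscillator ω f)‖) ^ 2 := by
    intro f
    have h1 := norm_toL2_laplacian_sq_add_le ω f
    have h2 : ‖toL2 f‖ ^ 2 ≤ (c * ‖toL2 (oscillator ω f)‖) ^ 2 :=
      pow_le_pow_left₀ (norm_nonneg _) (hc f) 2
    have h3 := mul_le_mul_of_nonneg_left h2 (by positivity : 0 ≤ 2 * S)
    rw [mul_pow, hκ2]
    linarith
  have hΔ : ∀ f, ‖toL2 (Δ f)‖ ≤ κ * ‖toL2 (oscillator ω f)‖ := fun f =>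
    (sq_le_sq₀ (norm_nonneg _) (by positivity)).1
      ((le_add_of_nonneg_right (sq_nonneg _)).trans (hgraph f))
  have hQf : ∀ f, ‖toL2 (Q f)‖ ≤ κ * ‖toL2 (oscillator ω f)‖ := fun f =>
    (sq_le_sq₀ (norm_nonneg _) (by positivity)).1
      ((le_add_of_nonneg_left (sq_nonneg _)).trans (hgraph f))
  set M := K * (c + κ) with hM
  have hM0 : 0 ≤ M := by positivity
  have hsup : ∀ f x, ‖f x‖ ≤ M * ‖toL2 (oscillator ω f)‖ := by
    intro f x
    refine (hK f x).trans ?_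
    rw [hM, mul_assoc]
    refine mul_le_mul_of_nonneg_left ?_ hK0
    rw [add_mul]
    exact add_le_add (hc f) (hΔ f)
  exact ⟨κ, M, hκ0, hM0, fun f => ⟨hΔ f, hQf f, hsup f⟩⟩

theorem norm_toL2_pmul_le_mul {p q : 𝓢(EuclideanSpace ℝ (Fin d), ℂ)} {m n : ℝ}
    (hp : ‖toL2 p‖ ≤ n) (hq : ∀ x, ‖q x‖ ≤ m) : ‖toL2 (pmul p q)‖ ≤ m * n := by
  have hm : 0 ≤ m := (norm_nonneg _).trans (hq 0)
  refine le_trans (norm_toL2_le_mul fun x => ?_) (mul_le_mul_of_nonneg_left hp hm)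
  rw [pmul_apply, norm_mul, mul_comm]
  exact mul_le_mul_of_nonneg_right (hq x) (norm_nonneg _)

theorem norm_toL2_pmul_le_of_self {p q : 𝓢(EuclideanSpace ℝ (Fin d), ℂ)} {m a b : ℝ} (hm : 0 ≤ m)
    (ha : 0 ≤ a) (hb : 0 ≤ b) (hp : ‖toL2 (pmul p p)‖ ≤ m * a ^ 2)
    (hq : ‖toL2 (pmul q q)‖ ≤ m * b ^ 2) : ‖toL2 (pmul p q)‖ ≤ m * a * b := by
  have h : ‖toL2 (pmul p q)‖ ^ 2 ≤ (m * a * b) ^ 2 :=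
    calc ‖toL2 (pmul p q)‖ ^ 2 ≤ ‖toL2 (pmul p p)‖ * ‖toL2 (pmul q q)‖ :=
          norm_toL2_pmul_le_sqrt p q
      _ ≤ (m * a ^ 2) * (m * b ^ 2) := by gcongr
      _ = (m * a * b) ^ 2 := by ring
  exact (pow_le_pow_iff_left₀ (norm_nonneg _) (by positivity) two_ne_zero).1 h

theorem pmul_comm (p q : 𝓢(EuclideanSpace ℝ (Fin d), ℂ)) : pmul p q = pmul q p := by
  ext x
  simp [mul_comm]

theorem smulLeftCLM_trapPotential_pmul (ω : Fin d → ℝ) (f g : 𝓢(EuclideanSpace ℝ (Fin d), ℂ)) :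
    smulLeftCLM ℂ (fun x => (trapPotential ω x : ℂ)) (pmul f g) =
      pmul (smulLeftCLM ℂ (fun x => (trapPotential ω x : ℂ)) f) g := by
  ext x
  rw [smulLeftCLM_trapPotential_apply, pmul_apply, pmul_apply, smulLeftCLM_trapPotential_apply]
  ring

/-- If `-Δ + Ω` is bounded below, its graph norm is submultiplicative up to a constant. -/
theorem exists_norm_toL2_oscillator_pmul_le (hd : d ≤ 3) (ω : Fin d → ℝ) {c : ℝ} (hc0 : 0 ≤ c)
    (hc : ∀ f : 𝓢(EuclideanSpace ℝ (Fin d), ℂ), ‖toL2 f‖ ≤ c * ‖toL2 (oscillator ω f)‖) :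
    ∃ C : ℝ, 0 < C ∧ ∀ f g : 𝓢(EuclideanSpace ℝ (Fin d), ℂ),
      ‖toL2 (oscillator ω (pmul f g))‖ ≤
        C * ‖toL2 (oscillator ω f)‖ * ‖toL2 (oscillator ω g)‖ := by
  obtain ⟨κ, M, hκ0, hM0, h⟩ := exists_norm_le_mul_norm_toL2_oscillator hd ω hc0 hc
  -- The terms `(Δf)g`, `fΔg` and `(Ωf)g` cost `Mκ` each, and the gradient term costs `2 · d · 3Mκ`;
  -- the `+ 1` makes the constant positive.
  refine ⟨(3 + 6 * d) * M * κ + 1, by positivity, fun f g => ?_⟩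
  set a := ‖toL2 (oscillator ω f)‖ with ha
  set b := ‖toL2 (oscillator ω g)‖ with hb
  have ha0 : 0 ≤ a := norm_nonneg _
  have hb0 : 0 ≤ b := norm_nonneg _
  have t1 : ‖toL2 (pmul (Δ f) g)‖ ≤ M * b * (κ * a) := norm_toL2_pmul_le_mul (h f).1 (h g).2.2
  have t2 : ‖toL2 (pmul f (Δ g))‖ ≤ M * a * (κ * b) := by
    rw [pmul_comm]
    exact norm_toL2_pmul_le_mul (h g).1 (h f).2.2
  have t3 : ‖toL2 (smulLeftCLM ℂ (fun x => (trapPotential ω x : ℂ)) (pmul f g))‖ ≤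
      M * b * (κ * a) := by
    rw [smulLeftCLM_trapPotential_pmul]
    exact norm_toL2_pmul_le_mul (h f).2.1 (h g).2.2
  have hself : ∀ (u : 𝓢(EuclideanSpace ℝ (Fin d), ℂ)) (j : Fin d),
      ‖toL2 (pmul (∂_{EuclideanSpace.basisFun (Fin d) ℝ j} u)
        (∂_{EuclideanSpace.basisFun (Fin d) ℝ j} u))‖ ≤
      3 * M * κ * ‖toL2 (oscillator ω u)‖ ^ 2 := by
    intro u j
    refine (norm_toL2_pmul_lineDerivOp_self_le u _ (h u).2.2).trans ?_
    have h1 := (norm_toL2_lineDerivOp_lineDerivOp_le (EuclideanSpace.basisFun (Fin d) ℝ) u j).trans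
      (h u).1
    calc _ ≤ 3 * (M * ‖toL2 (oscillator ω u)‖) * (κ * ‖toL2 (oscillator ω u)‖) :=
          mul_le_mul_of_nonneg_left h1 (by positivity)
      _ = _ := by ring
  have t4 : ∀ j : Fin d, ‖toL2 (pmul (∂_{EuclideanSpace.basisFun (Fin d) ℝ j} f)
      (∂_{EuclideanSpace.basisFun (Fin d) ℝ j} g))‖ ≤ 3 * M * κ * a * b := fun j =>
    norm_toL2_pmul_le_of_self (by positivity) ha0 hb0 (hself f j) (hself g j)
  have t5 : ‖toL2 (Δ (pmul f g))‖ ≤ M * b * (κ * a) + M * a * (κ * b) +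
      2 * (d * (3 * M * κ * a * b)) := by
    rw [laplacian_pmul, map_add, map_add, map_smul, map_sum]
    refine (norm_add_le _ _).trans (add_le_add ((norm_add_le _ _).trans (add_le_add t1 t2)) ?_)
    rw [norm_smul, Complex.norm_ofNat]
    refine mul_le_mul_of_nonneg_left ((norm_sum_le_of_le _ fun j _ => t4 j).trans ?_) zero_le_two
    simp
  have t6 : ‖toL2 (oscillator ω (pmul f g))‖ ≤
      ‖toL2 (Δ (pmul f g))‖ + ‖toL2 (smulLeftCLM ℂ (fun x => (trapPotential ω x : ℂ)) (pmul f g))‖ := by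
    rw [oscillator_eq, map_add, map_neg]
    exact (norm_add_le _ _).trans (by rw [norm_neg])
  nlinarith [mul_nonneg ha0 hb0]

end Oscillator

end SchwartzMap

/-! ### Gaussians times functions of temperate growth are Schwartz. -/

section GaussianDecay

open Function

/-- The power is absorbed by `N! e^{1+t}`, and completing the square gives `t - ct² ≤ 1/(4c)`. -/
theorem one_add_pow_mul_exp_neg_mul_sq_le (N : ℕ) {c t : ℝ} (hc : 0 < c) (ht : 0 ≤ t) :
    (1 + t) ^ N * Real.exp (-(c * t ^ 2)) ≤ N.factorial * Real.exp (1 + 1 / (4 * c)) := by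
  have h1 : (1 + t) ^ N ≤ N.factorial * Real.exp (1 + t) := by
    have := Real.pow_div_factorial_le_exp (1 + t) (by positivity) N
    rw [div_le_iff₀ (by positivity)] at this
    linarith
  have h2 : 1 + t + -(c * t ^ 2) ≤ 1 + 1 / (4 * c) := by
    have h3 : 1 / (4 * c) - t + c * t ^ 2 = (2 * c * t - 1) ^ 2 / (4 * c) := by
      field_simp
      ring
    have h4 : 0 ≤ (2 * c * t - 1) ^ 2 / (4 * c) := by positivity
    linarith
  calc (1 + t) ^ N * Real.exp (-(c * t ^ 2))
      ≤ N.factorial * Real.exp (1 + t) * Real.exp (-(c * t ^ 2)) := by gcongr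
    _ = N.factorial * Real.exp (1 + t + -(c * t ^ 2)) := by rw [Real.exp_add (1 + t)]; ring
    _ ≤ _ := by gcongr

variable {E : Type} [NormedAddCommGroup E] [NormedSpace ℝ E]

theorem Function.HasTemperateGrowth.fderiv_right {F : Type*} [NormedAddCommGroup F]
    [NormedSpace ℝ F] {f : E → F} (hf : f.HasTemperateGrowth) :
    (fun x => fderiv ℝ f x).HasTemperateGrowth := by
  refine ⟨(contDiff_succ_iff_fderiv.1 (hf.1.of_le (by simp))).2.2, fun n => ?_⟩
  obtain ⟨k, C, hC⟩ := hf.2 (n + 1)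
  refine ⟨k, C, fun x => ?_⟩
  rw [norm_iteratedFDeriv_fderiv]
  exact hC x

/-- All derivatives of `e^{-q} P`, with `q` quadratically coercive, decay rapidly. -/
theorem exists_pow_mul_iteratedFDeriv_exp_neg_smul_le {q : E → ℝ} (hq : q.HasTemperateGrowth)
    {c : ℝ} (hc : 0 < c) (hqc : ∀ x, c * ‖x‖ ^ 2 ≤ q x) (k n : ℕ) :
    ∀ {F : Type} [NormedAddCommGroup F] [NormedSpace ℝ F] {P : E → F}, P.HasTemperateGrowth →
      ∃ C : ℝ, ∀ x, ‖x‖ ^ k * ‖iteratedFDeriv ℝ n (fun x => Real.exp (-q x) • P x) x‖ ≤ C := by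
  induction n with
  | zero =>
    intro F _ _ P hP
    obtain ⟨m, C, hC⟩ := hP.2 0
    have hC0 : 0 ≤ C := by simpa using (norm_nonneg _).trans (hC 0)
    refine ⟨C * ((k + m).factorial * Real.exp (1 + 1 / (4 * c))), fun x => ?_⟩
    have h1 := hC x
    rw [norm_iteratedFDeriv_zero] at h1 ⊢
    rw [norm_smul, Real.norm_of_nonneg (Real.exp_pos _).le]
    calc ‖x‖ ^ k * (Real.exp (-q x) * ‖P x‖)
        ≤ (1 + ‖x‖) ^ k * (Real.exp (-(c * ‖x‖ ^ 2)) * (C * (1 + ‖x‖) ^ m)) := by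
          gcongr
          · linarith
          · exact hqc x
      _ = C * ((1 + ‖x‖) ^ (k + m) * Real.exp (-(c * ‖x‖ ^ 2))) := by ring
      _ ≤ _ := by
          exact mul_le_mul_of_nonneg_left
            (one_add_pow_mul_exp_neg_mul_sq_le _ hc (norm_nonneg x)) hC0
  | succ n ih =>
    intro F _ _ P hP
    have hdq : Differentiable ℝ q := hq.1.differentiable (by simp)
    have hdP : Differentiable ℝ P := hP.1.differentiable (by simp)
    -- The derivative has the same shape with a new coefficient valued in `E →L[ℝ] F`. Hence `F` and
    -- `P` are quantified inside the induction, and `E` and `F` share a universe.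
    have hf : fderiv ℝ (fun x => Real.exp (-q x) • P x) =
        fun x => Real.exp (-q x) • (fderiv ℝ P x - (fderiv ℝ q x).smulRight (P x)) := by
      ext1 x
      have h := ((hdq x).hasFDerivAt.neg.exp.smul (hdP x).hasFDerivAt).fderiv
      refine Eq.trans h ?_
      ext v
      simp [mul_smul, smul_sub]
      abel
    have hP' : (fun x => fderiv ℝ P x - (fderiv ℝ q x).smulRight (P x)).HasTemperateGrowth := by
      refine HasTemperateGrowth.sub hP.fderiv_right ?_
      exact (ContinuousLinearMap.smulRightL ℝ E F).bilinear_hasTemperateGrowth hq.fderiv_right hP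
    obtain ⟨C, hC⟩ := ih hP'
    refine ⟨C, fun x => ?_⟩
    rw [← norm_iteratedFDeriv_fderiv, hf]
    exact hC x

/-- The Schwartz function `e^{-q} P`. -/
noncomputable def SchwartzMap.expNegSMul {q : E → ℝ} (hq : q.HasTemperateGrowth)
    {c : ℝ} (hc : 0 < c) (hqc : ∀ x, c * ‖x‖ ^ 2 ≤ q x) {F : Type} [NormedAddCommGroup F]
    [NormedSpace ℝ F] {P : E → F} (hP : P.HasTemperateGrowth) : 𝓢(E, F) where
  toFun x := Real.exp (-q x) • P x
  smooth' := (Real.contDiff_exp.comp hq.1.neg).smul hP.1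
  decay' k n := exists_pow_mul_iteratedFDeriv_exp_neg_smul_le hq hc hqc k n hP

theorem Function.HasTemperateGrowth.finset_prod {ι : Type*} {f : ι → E → ℝ} (s : Finset ι)
    (hf : ∀ i, (f i).HasTemperateGrowth) : (fun x => ∏ i ∈ s, f i x).HasTemperateGrowth := by
  classical
  induction s using Finset.induction_on with
  | empty => simp
  | insert a s ha ih =>
    simp only [Finset.prod_insert ha]
    have := hf a
    fun_prop

theorem Function.HasTemperateGrowth.aeval {f : E → ℝ} (hf : f.HasTemperateGrowth)
    (p : Polynomial ℤ) : (fun x => Polynomial.aeval (f x) p).HasTemperateGrowth := by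
  induction p using Polynomial.induction_on' with
  | add p q hp hq => simp only [map_add]; fun_prop
  | monomial n a =>
    simp only [Polynomial.aeval_monomial]
    fun_prop

end GaussianDecay

/-! ### Hermite polynomials and functions in one variable. -/

section Hermite

open Polynomial

theorem derivative_hermite_succ (n : ℕ) :
    derivative (hermite (n + 1)) = (n + 1 : ℤ[X]) * hermite n := by
  induction n with
  | zero => simp
  | succ n ih =>
    rw [hermite_succ (n + 1), derivative_sub, derivative_mul, ih, derivative_mul]
    have h := hermite_succ n
    simp only [derivative_X, derivative_add, derivative_one, derivative_natCast]
    push_cast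
    linear_combination (-(n + 1 : ℤ[X])) * h

/-- At index `n + 1` the left side is `n + 1` times the recurrence `He_{n+1} = X He_n - He_n'`, by
the derivative formula above. -/
theorem hermite_differential_equation (n : ℕ) :
    derivative (derivative (hermite n)) - X * derivative (hermite n) + (n : ℤ[X]) * hermite n =
      0 := by
  cases n with
  | zero => simp
  | succ n =>
    have h := hermite_succ n
    rw [derivative_hermite_succ, derivative_mul]
    simp only [derivative_add, derivative_one, derivative_natCast]
    push_cast
    linear_combination (n + 1 : ℤ[X]) * h

/-- The derivative of the Hermite function. -/
noncomputable def hermiteFunctionDeriv (n : ℕ) (x : ℝ) : ℝ :=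
  (√((n.factorial : ℝ) * √Real.pi))⁻¹ *
    ((√2 * aeval (√2 * x) (derivative (hermite n)) - x * aeval (√2 * x) (hermite n)) *
      Real.exp (-(x ^ 2) / 2))

theorem hasDerivAt_aeval_sqrt_two_mul (p : ℤ[X]) (x : ℝ) :
    HasDerivAt (fun x : ℝ => aeval (√2 * x) p) (√2 * aeval (√2 * x) (derivative p)) x := by
  have h := (Polynomial.hasDerivAt_aeval (q := p) (√2 * x)).comp x
    ((hasDerivAt_id x).const_mul √2)
  exact h.congr_deriv (by simp [mul_comm])

theorem hasDerivAt_exp_neg_sq_div_two (x : ℝ) :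
    HasDerivAt (fun x : ℝ => Real.exp (-(x ^ 2) / 2)) (-x * Real.exp (-(x ^ 2) / 2)) x := by
  have h := ((hasDerivAt_pow 2 x).neg.div_const 2).exp
  exact h.congr_deriv (by simp; ring)

theorem hasDerivAt_hermiteFunction (n : ℕ) (x : ℝ) :
    HasDerivAt (hermiteFunction n) (hermiteFunctionDeriv n x) x := by
  have h := ((hasDerivAt_aeval_sqrt_two_mul (hermite n) x).mul
    (hasDerivAt_exp_neg_sq_div_two x)).const_mul (√((n.factorial : ℝ) * √Real.pi))⁻¹
  refine h.congr_deriv ?_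
  rw [hermiteFunctionDeriv]
  ring

/-- The one-dimensional eigenvalue equation: the Hermite equation at `√2 x` eliminates the second
derivative of the polynomial factor. -/
theorem hasDerivAt_hermiteFunctionDeriv (n : ℕ) (x : ℝ) :
    HasDerivAt (hermiteFunctionDeriv n) ((x ^ 2 - (2 * n + 1)) * hermiteFunction n x) x := by
  have h := ((((hasDerivAt_aeval_sqrt_two_mul (derivative (hermite n)) x).const_mul √2).sub
    ((hasDerivAt_id x).mul (hasDerivAt_aeval_sqrt_two_mul (hermite n) x))).mul
    (hasDerivAt_exp_neg_sq_div_two x)).const_mul (√((n.factorial : ℝ) * √Real.pi))⁻¹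
  have ode := congrArg (aeval (√2 * x)) (hermite_differential_equation n)
  simp only [map_add, map_sub, map_mul, aeval_X, map_natCast, map_zero] at ode
  have h2 : √2 * √2 = 2 := Real.mul_self_sqrt (by norm_num)
  refine h.congr_deriv ?_
  rw [hermiteFunction]
  simp only [id, Pi.sub_apply, Pi.mul_apply]
  set c := (√((n.factorial : ℝ) * √Real.pi))⁻¹
  set e := Real.exp (-(x ^ 2) / 2)
  set a0 := aeval (√2 * x) (hermite n)
  set a1 := aeval (√2 * x) (derivative (hermite n))
  set a2 := aeval (√2 * x) (derivative (derivative (hermite n)))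
  have ha2 : a2 = √2 * x * a1 - n * a0 := by linarith
  rw [ha2]
  linear_combination (c * e * x * √2 * a1 - c * e * n * a0) * h2

theorem integrable_aeval_mul_exp_neg_sq_div_two (p : ℤ[X]) :
    Integrable (fun x : ℝ => aeval x p * Real.exp (-(x ^ 2) / 2)) := by
  induction p using Polynomial.induction_on' with
  | add p q hp hq =>
    refine (hp.add hq).congr (Filter.Eventually.of_forall fun x => ?_)
    simp [add_mul]
  | monomial n a =>
    have h := (integrable_rpow_mul_exp_neg_mul_sq (b := 1 / 2) (by norm_num)
      (s := n) (by linarith [n.cast_nonneg (α := ℝ)])).const_mul (a : ℝ)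
    refine h.congr (Filter.Eventually.of_forall fun x => ?_)
    simp [mul_assoc, div_eq_inv_mul]

/-- Integration by parts, since `He_{n+1} e^{-x²/2}` is minus the derivative of `He_n e^{-x²/2}`. -/
theorem integral_hermite_mul_hermite_succ (p : ℤ[X]) (n : ℕ) :
    ∫ x : ℝ, aeval x (p * hermite (n + 1)) * Real.exp (-(x ^ 2) / 2) =
      ∫ x : ℝ, aeval x (derivative p * hermite n) * Real.exp (-(x ^ 2) / 2) := by
  have hv : ∀ x : ℝ, HasDerivAt (fun x : ℝ => aeval x (hermite n) * Real.exp (-(x ^ 2) / 2))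
      (-(aeval x (hermite (n + 1)) * Real.exp (-(x ^ 2) / 2))) x := by
    intro x
    refine ((Polynomial.hasDerivAt_aeval (q := hermite n) x).mul
      (hasDerivAt_exp_neg_sq_div_two x)).congr_deriv ?_
    rw [hermite_succ]
    simp
    ring
  have hi := integrable_aeval_mul_exp_neg_sq_div_two
  have h := integral_mul_deriv_eq_deriv_mul_of_integrable
    (u := fun x : ℝ => aeval x p) (u' := fun x : ℝ => aeval x (derivative p))
    (v := fun x : ℝ => aeval x (hermite n) * Real.exp (-(x ^ 2) / 2))
    (v' := fun x : ℝ => -(aeval x (hermite (n + 1)) * Real.exp (-(x ^ 2) / 2)))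
    (fun x _ => Polynomial.hasDerivAt_aeval p x) (fun x _ => hv x)
    ((hi (p * hermite (n + 1))).neg.congr (ae_of_all _ fun x => by simp [mul_assoc]))
    ((hi (derivative p * hermite n)).congr (ae_of_all _ fun x => by simp [mul_assoc]))
    ((hi (p * hermite n)).congr (ae_of_all _ fun x => by simp [mul_assoc]))
  simp only [mul_neg, integral_neg, neg_inj] at h
  simpa [mul_assoc] using h

/-- Orthogonality of the Hermite polynomials in `L²(e^{-y²/2})`. -/
theorem integral_hermite_mul_hermite (m n : ℕ) :
    ∫ x : ℝ, aeval x (hermite m * hermite n) * Real.exp (-(x ^ 2) / 2) =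
      if m = n then (n.factorial : ℝ) * √(2 * Real.pi) else 0 := by
  induction n generalizing m with
  | zero =>
    cases m with
    | zero =>
      have h := integral_gaussian (1 / 2)
      simp only [hermite_zero, map_one, one_mul]
      simp only [if_true, Nat.factorial_zero, Nat.cast_one, one_mul]
      rw [show 2 * Real.pi = Real.pi / (1 / 2) by ring, ← h]
      simp [div_eq_inv_mul]
    | succ m =>
      rw [mul_comm, integral_hermite_mul_hermite_succ]
      simp
  | succ n ih =>
    rw [integral_hermite_mul_hermite_succ]
    cases m with
    | zero => simp
    | succ m =>
      rw [derivative_hermite_succ]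
      have e : ∀ x : ℝ, aeval x ((m + 1 : ℤ[X]) * hermite m * hermite n) *
          Real.exp (-(x ^ 2) / 2) = (m + 1 : ℝ) *
            (aeval x (hermite m * hermite n) * Real.exp (-(x ^ 2) / 2)) := by
        intro x
        simp
        ring
      simp only [e]
      rw [integral_const_mul, ih]
      by_cases hmn : m = n
      · simp [hmn, Nat.factorial_succ, mul_assoc]
      · simp [hmn]

theorem integral_hermiteFunction_mul_hermiteFunction (m n : ℕ) :
    ∫ x : ℝ, hermiteFunction m x * hermiteFunction n x = if m = n then 1 else 0 := by
  set G : ℝ → ℝ := fun y => aeval y (hermite m * hermite n) * Real.exp (-(y ^ 2) / 2) with hG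
  have e : ∀ x : ℝ, hermiteFunction m x * hermiteFunction n x =
      ((√((m.factorial : ℝ) * √Real.pi))⁻¹ * (√((n.factorial : ℝ) * √Real.pi))⁻¹) *
        G (√2 * x) := by
    intro x
    have h2 : (√2 * x) ^ 2 = 2 * x ^ 2 := by
      rw [mul_pow, Real.sq_sqrt (by norm_num)]
    have h3 : Real.exp (-(2 * x ^ 2) / 2) =
        Real.exp (-(x ^ 2) / 2) * Real.exp (-(x ^ 2) / 2) := by
      rw [← Real.exp_add]
      congr 1
      ring
    simp only [hG, h2, h3, hermiteFunction, map_mul]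
    ring
  simp only [e]
  rw [integral_const_mul, Measure.integral_comp_mul_left, hG, integral_hermite_mul_hermite]
  by_cases hmn : m = n
  · subst hmn
    have hf : (0 : ℝ) < m.factorial := by positivity
    have hpi := Real.pi_pos
    rw [if_pos rfl, if_pos rfl, ← mul_inv, Real.mul_self_sqrt (by positivity),
      Real.sqrt_mul (by norm_num), abs_of_nonneg (by positivity), smul_eq_mul]
    field_simp
  · simp [hmn]

end Hermite

/-! ### The eigenfunctions as an orthonormal family of Schwartz functions. -/

section Eigenfunctions

open Polynomial

variable {d : ℕ} {ω : Fin d → ℝ}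

/-- The exponent of the ground state. -/
noncomputable def groundExponent (ω : Fin d → ℝ) (x : EuclideanSpace ℝ (Fin d)) : ℝ :=
  ∑ j, ω j / 2 * x j ^ 2

theorem hasTemperateGrowth_real_coord (j : Fin d) :
    (fun x : EuclideanSpace ℝ (Fin d) => x j).HasTemperateGrowth :=
  (EuclideanSpace.proj (𝕜 := ℝ) j).hasTemperateGrowth

theorem hasTemperateGrowth_groundExponent (ω : Fin d → ℝ) :
    (groundExponent ω).HasTemperateGrowth := by
  have := fun j : Fin d => hasTemperateGrowth_real_coord j
  unfold groundExponent
  fun_prop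

theorem exists_mul_norm_sq_le_groundExponent (hω : ∀ j, 0 < ω j) :
    ∃ c : ℝ, 0 < c ∧ ∀ x, c * ‖x‖ ^ 2 ≤ groundExponent ω x := by
  have hs : 0 ≤ ∑ j, (ω j)⁻¹ := Finset.sum_nonneg fun j _ => (inv_pos.2 (hω j)).le
  refine ⟨(1 + ∑ j, (ω j)⁻¹)⁻¹ / 2, by positivity, fun x => ?_⟩
  rw [EuclideanSpace.norm_sq_eq, Finset.mul_sum, groundExponent]
  refine Finset.sum_le_sum fun j _ => ?_
  rw [Real.norm_eq_abs, sq_abs]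
  refine mul_le_mul_of_nonneg_right (div_le_div_of_nonneg_right ?_ zero_le_two) (sq_nonneg _)
  rw [inv_le_comm₀ (by positivity) (hω j)]
  have := Finset.single_le_sum (f := fun j => (ω j)⁻¹)
    (fun i _ => (inv_pos.2 (hω i)).le) (Finset.mem_univ j)
  linarith

/-- The polynomial factor of the eigenfunction `φ_k`. -/
noncomputable def oscillatorPolynomial (ω : Fin d → ℝ) (k : Fin d → ℕ)
    (x : EuclideanSpace ℝ (Fin d)) : ℝ :=
  ∏ j, ω j ^ (1 / 4 : ℝ) * ((√(((k j).factorial : ℝ) * √Real.pi))⁻¹ *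
    aeval (√2 * (√(ω j) * x j)) (hermite (k j)))

theorem hasTemperateGrowth_oscillatorPolynomial (ω : Fin d → ℝ) (k : Fin d → ℕ) :
    (oscillatorPolynomial ω k).HasTemperateGrowth := by
  refine Function.HasTemperateGrowth.finset_prod _ fun j => ?_
  have h0 := hasTemperateGrowth_real_coord j
  have h1 : (fun x : EuclideanSpace ℝ (Fin d) =>
      aeval (√2 * (√(ω j) * x j)) (hermite (k j))).HasTemperateGrowth := by
    refine Function.HasTemperateGrowth.aeval ?_ _
    fun_prop
  fun_prop

theorem oscillatorEigenfunction_eq (hω : ∀ j, 0 < ω j) (k : Fin d → ℕ)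
    (x : EuclideanSpace ℝ (Fin d)) :
    oscillatorEigenfunction ω k x =
      Real.exp (-groundExponent ω x) * oscillatorPolynomial ω k x := by
  rw [oscillatorEigenfunction, groundExponent, ← Finset.sum_neg_distrib, Real.exp_sum,
    oscillatorPolynomial, ← Finset.prod_mul_distrib]
  refine Finset.prod_congr rfl fun j _ => ?_
  rw [hermiteFunction, mul_pow, Real.sq_sqrt (hω j).le,
    show -(ω j * x j ^ 2) / 2 = -(ω j / 2 * x j ^ 2) by ring]
  ring

/-- The eigenfunction `φ_k` as a Schwartz function. -/
noncomputable def oscillatorEigenSchwartz (hω : ∀ j, 0 < ω j) (k : Fin d → ℕ) :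
    𝓢(EuclideanSpace ℝ (Fin d), ℂ) :=
  SchwartzMap.postcompCLM Complex.ofRealCLM
    (SchwartzMap.expNegSMul (hasTemperateGrowth_groundExponent ω)
      (exists_mul_norm_sq_le_groundExponent hω).choose_spec.1
      (exists_mul_norm_sq_le_groundExponent hω).choose_spec.2
      (hasTemperateGrowth_oscillatorPolynomial ω k))

theorem oscillatorEigenSchwartz_apply (hω : ∀ j, 0 < ω j) (k : Fin d → ℕ)
    (x : EuclideanSpace ℝ (Fin d)) :
    oscillatorEigenSchwartz hω k x = oscillatorEigenfunction ω k x := by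
  rw [oscillatorEigenfunction_eq hω]
  rfl

theorem toL2_oscillatorEigenSchwartz (hω : ∀ j, 0 < ω j) (k : Fin d → ℕ) :
    SchwartzMap.toL2 (oscillatorEigenSchwartz hω k) = oscillatorEigenvector hω k := by
  exact MemLp.toLp_congr ((oscillatorEigenSchwartz hω k).memLp 2 volume)
    (memLp_oscillatorEigenfunction hω k)
    (ae_of_all _ fun x => oscillatorEigenSchwartz_apply hω k x)

/-- The factor `R` does not depend on `xⱼ`. The conclusion has the form of the hypothesis `hf`, so
the lemma can be iterated for second derivatives. -/
theorem SchwartzMap.lineDerivOp_basisFun_apply {f : 𝓢(EuclideanSpace ℝ (Fin d), ℂ)} {j : Fin d}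
    {R : EuclideanSpace ℝ (Fin d) → ℂ} {G G' : ℝ → ℝ}
    (hR : ∀ x (t : ℝ), R (x + t • EuclideanSpace.basisFun (Fin d) ℝ j) = R x)
    (hf : ∀ x, f x = R x * G (x j)) (hG : ∀ y, HasDerivAt G (G' y) y)
    (x : EuclideanSpace ℝ (Fin d)) :
    ∂_{EuclideanSpace.basisFun (Fin d) ℝ j} f x = R x * G' (x j) := by
  rw [SchwartzMap.lineDerivOp_apply, lineDeriv]
  have e : (fun t : ℝ => f (x + t • EuclideanSpace.basisFun (Fin d) ℝ j)) =
      fun t : ℝ => R x * (G (x j + t) : ℂ) := by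
    ext t
    rw [hf, hR]
    simp
  rw [e]
  refine HasDerivAt.deriv (HasDerivAt.const_mul _ (HasDerivAt.ofReal_comp ?_))
  simpa using (hG (x j + 0)).comp_const_add (x j) 0

theorem lineDerivOp_lineDerivOp_oscillatorEigenSchwartz (hω : ∀ j, 0 < ω j) (k : Fin d → ℕ)
    (j : Fin d) (x : EuclideanSpace ℝ (Fin d)) :
    ∂_{EuclideanSpace.basisFun (Fin d) ℝ j} (∂_{EuclideanSpace.basisFun (Fin d) ℝ j}
      (oscillatorEigenSchwartz hω k)) x =
      ((ω j ^ 2 * x j ^ 2 - ω j * (2 * k j + 1) : ℝ) : ℂ) * oscillatorEigenSchwartz hω k x := by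
  set R : EuclideanSpace ℝ (Fin d) → ℂ := fun x =>
    ((∏ i ∈ Finset.univ.erase j, ω i ^ (1 / 4 : ℝ) * hermiteFunction (k i) (√(ω i) * x i) : ℝ) : ℂ)
    with hRdef
  have hR : ∀ x (t : ℝ), R (x + t • EuclideanSpace.basisFun (Fin d) ℝ j) = R x := by
    intro x t
    simp only [hRdef]
    congr 1
    refine Finset.prod_congr rfl fun i hi => ?_
    simp [Finset.ne_of_mem_erase hi]
  have hf : ∀ x, oscillatorEigenSchwartz hω k x =
      R x * ((ω j ^ (1 / 4 : ℝ) * hermiteFunction (k j) (√(ω j) * x j) : ℝ) : ℂ) := by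
    intro x
    rw [oscillatorEigenSchwartz_apply, oscillatorEigenfunction,
      ← Finset.prod_erase_mul _ _ (Finset.mem_univ j), Complex.ofReal_mul]
  have hG : ∀ y, HasDerivAt (fun y => ω j ^ (1 / 4 : ℝ) * hermiteFunction (k j) (√(ω j) * y))
      (ω j ^ (1 / 4 : ℝ) * (hermiteFunctionDeriv (k j) (√(ω j) * y) * √(ω j))) y := fun y =>
    ((hasDerivAt_hermiteFunction (k j) (√(ω j) * y)).comp y
      (by simpa using (hasDerivAt_id y).const_mul √(ω j))).const_mul _
  have hG' : ∀ y, HasDerivAt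
      (fun y => ω j ^ (1 / 4 : ℝ) * (hermiteFunctionDeriv (k j) (√(ω j) * y) * √(ω j)))
      (ω j ^ (1 / 4 : ℝ) * ((((√(ω j) * y) ^ 2 - (2 * k j + 1)) *
        hermiteFunction (k j) (√(ω j) * y) * √(ω j)) * √(ω j))) y := fun y =>
    (((hasDerivAt_hermiteFunctionDeriv (k j) (√(ω j) * y)).comp y
      (by simpa using (hasDerivAt_id y).const_mul √(ω j))).mul_const _).const_mul _
  rw [SchwartzMap.lineDerivOp_basisFun_apply hR
    (fun x => SchwartzMap.lineDerivOp_basisFun_apply hR hf hG x) hG' x, hf x]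
  have h2 := Real.sq_sqrt (hω j).le
  have h3 : ω j ^ 2 * x j ^ 2 - ω j * (2 * k j + 1) =
      ((√(ω j) * x j) ^ 2 - (2 * k j + 1)) * √(ω j) ^ 2 := by
    rw [mul_pow, h2]
    ring
  rw [h3]
  push_cast
  ring

theorem oscillator_oscillatorEigenSchwartz (hω : ∀ j, 0 < ω j) (k : Fin d → ℕ) :
    SchwartzMap.oscillator ω (oscillatorEigenSchwartz hω k) =
      (oscillatorEigenvalue ω k : ℂ) • oscillatorEigenSchwartz hω k := by
  ext x
  rw [SchwartzMap.oscillator_eq, SchwartzMap.laplacian_eq_sum (EuclideanSpace.basisFun (Fin d) ℝ),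
    add_apply, neg_apply, sum_apply, SchwartzMap.smulLeftCLM_trapPotential_apply, smul_apply]
  simp only [lineDerivOp_lineDerivOp_oscillatorEigenSchwartz]
  rw [← Finset.sum_mul, ← Complex.ofReal_sum, Finset.sum_sub_distrib, trapPotential,
    oscillatorEigenvalue]
  push_cast
  rw [smul_eq_mul]
  ring

/-- The integral factors over the coordinates; in each, the `√ωⱼ` from the two normalisations
cancels the Jacobian of `y ↦ √ωⱼ y`. -/
theorem orthonormal_oscillatorEigenvector (hω : ∀ j, 0 < ω j) :
    Orthonormal ℂ (oscillatorEigenvector hω) := by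
  classical
  rw [orthonormal_iff_ite]
  intro k l
  rw [← toL2_oscillatorEigenSchwartz, ← toL2_oscillatorEigenSchwartz, SchwartzMap.toLpCLM_apply,
    SchwartzMap.toLpCLM_apply, SchwartzMap.inner_toL2_toL2_eq _ _ volume]
  have e : ∀ x, inner ℂ (oscillatorEigenSchwartz hω k x) (oscillatorEigenSchwartz hω l x) =
      ((∏ j, (fun j (y : ℝ) => √(ω j) * (hermiteFunction (k j) (√(ω j) * y) *
        hermiteFunction (l j) (√(ω j) * y))) j (x j) : ℝ) : ℂ) := by
    intro x
    rw [oscillatorEigenSchwartz_apply, oscillatorEigenSchwartz_apply, RCLike.inner_apply,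
      Complex.conj_ofReal, ← Complex.ofReal_mul, oscillatorEigenfunction, oscillatorEigenfunction,
      ← Finset.prod_mul_distrib]
    congr 1
    refine Finset.prod_congr rfl fun j _ => ?_
    have h : ω j ^ (1 / 4 : ℝ) * ω j ^ (1 / 4 : ℝ) = √(ω j) := by
      rw [← Real.rpow_add (hω j), Real.sqrt_eq_rpow]
      norm_num
    linear_combination (hermiteFunction (k j) (√(ω j) * x j) *
      hermiteFunction (l j) (√(ω j) * x j)) * h
  simp only [e]
  rw [integral_complex_ofReal]
  have h1 := (PiLp.volume_preserving_ofLp (Fin d)).integral_comp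
    (MeasurableEquiv.toLp 2 (Fin d → ℝ)).symm.measurableEmbedding
    (fun x : Fin d → ℝ => ∏ j, (fun j (y : ℝ) => √(ω j) * (hermiteFunction (k j) (√(ω j) * y) *
        hermiteFunction (l j) (√(ω j) * y))) j (x j))
  have h2 : ∀ j, ∫ y : ℝ, √(ω j) * (hermiteFunction (k j) (√(ω j) * y) *
        hermiteFunction (l j) (√(ω j) * y)) = if k j = l j then 1 else 0 := by
    intro j
    have hs := Real.sqrt_pos.2 (hω j)
    rw [integral_const_mul, Measure.integral_comp_mul_left
      (fun y => hermiteFunction (k j) y * hermiteFunction (l j) y),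
      integral_hermiteFunction_mul_hermiteFunction, abs_of_pos (inv_pos.2 hs), smul_eq_mul,
      mul_inv_cancel_left₀ hs.ne']
  have h3 : ∏ j, (if k j = l j then (1 : ℝ) else 0) = if k = l then 1 else 0 := by
    by_cases hkl : k = l
    · simp [hkl]
    · rw [if_neg hkl]
      obtain ⟨j, hj⟩ := Function.ne_iff.1 hkl
      exact Finset.prod_eq_zero (Finset.mem_univ j) (if_neg hj)
  rw [show (∫ x : EuclideanSpace ℝ (Fin d), ∏ j, (fun j (y : ℝ) => √(ω j) *
    (hermiteFunction (k j) (√(ω j) * y) * hermiteFunction (l j) (√(ω j) * y))) j (x j)) = _ from h1,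
    integral_fintype_prod_volume_eq_prod (fun j (y : ℝ) => √(ω j) *
      (hermiteFunction (k j) (√(ω j) * y) * hermiteFunction (l j) (√(ω j) * y)))]
  simp only [h2, h3]
  split_ifs <;> simp

end Eigenfunctions

/-! ### Injectivity of the Fourier transform on `L¹`. -/

section FourierInjective

variable {E : Type*} [NormedAddCommGroup E] [InnerProductSpace ℝ E] [FiniteDimensional ℝ E]
  [MeasurableSpace E] [BorelSpace E]

/-- An integrable function with vanishing Fourier transform vanishes almost everywhere. -/
theorem MeasureTheory.Integrable.ae_eq_zero_of_fourier_eq_zero {G : E → ℂ} (hG : Integrable G)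
    (h : ∀ ξ, 𝓕 G ξ = 0) : ∀ᵐ x, G x = 0 := by
  -- Write `f = 𝓕 (𝓕⁻ f)` and move the outer transform onto `G`.
  have key : ∀ f : 𝓢(E, ℂ), ∫ x, f x * G x = 0 := by
    intro f
    have e : 𝓕 (𝓕⁻ f) = f := FourierTransform.fourier_fourierInv_eq f
    have h1 : ∫ x, 𝓕 ((𝓕⁻ f : 𝓢(E, ℂ)) : E → ℂ) x * G x = ∫ x, (𝓕⁻ f : 𝓢(E, ℂ)) x * 𝓕 G x := by
      simpa using! VectorFourier.integral_bilin_fourierIntegral_eq_flip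
        (ContinuousLinearMap.mul ℂ ℂ) (L := innerₗ E) Real.continuous_fourierChar continuous_inner
        ((𝓕⁻ f : 𝓢(E, ℂ)).integrable (μ := volume)) hG
    rw [← SchwartzMap.fourier_coe, e] at h1
    rw [h1]
    simp [h]
  refine ae_eq_zero_of_integral_contDiff_smul_eq_zero hG.locallyIntegrable fun g hg hc => ?_
  have h1 : HasCompactSupport (Complex.ofRealCLM ∘ g) := hc.comp_left rfl
  have h2 : ContDiff ℝ (⊤ : ℕ∞) (Complex.ofRealCLM ∘ g) := by fun_prop
  simpa using key (h1.toSchwartzMap h2)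

end FourierInjective

/-! ### Completeness of the eigenfunctions in `L²`. -/

section Completeness

open Polynomial

/-- The Hermite polynomials over `ℂ`, as a polynomial sequence. -/
noncomputable def hermiteSequence : Polynomial.Sequence ℂ where
  elems' n := (hermite n).map (Int.castRingHom ℂ)
  degree_eq' n := by rw [(hermite_monic n).degree_map, degree_hermite]

theorem span_range_hermite :
    Submodule.span ℂ (Set.range fun n => (hermite n).map (Int.castRingHom ℂ)) = ⊤ := by
  refine hermiteSequence.span fun n => ?_
  have h : ((hermite n).map (Int.castRingHom ℂ)).Monic := (hermite_monic n).map _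
  change IsUnit ((hermite n).map (Int.castRingHom ℂ)).leadingCoeff
  rw [h.leadingCoeff]
  exact isUnit_one

variable {d : ℕ} {ω : Fin d → ℝ}

theorem Function.HasTemperateGrowth.finset_prod_complex {E ι : Type*} [NormedAddCommGroup E]
    [NormedSpace ℝ E] {f : ι → E → ℂ} (s : Finset ι)
    (hf : ∀ i, (f i).HasTemperateGrowth) : (fun x => ∏ i ∈ s, f i x).HasTemperateGrowth := by
  classical
  induction s using Finset.induction_on with
  | empty => simp
  | insert a s ha ih =>
    simp only [Finset.prod_insert ha]
    have := hf a
    fun_prop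

theorem hasTemperateGrowth_eval_coord (p : ℂ[X]) (a : ℝ) (j : Fin d) :
    (fun x : EuclideanSpace ℝ (Fin d) => p.eval ((a * x j : ℝ) : ℂ)).HasTemperateGrowth := by
  have := hasTemperateGrowth_real_coord j
  induction p using Polynomial.induction_on' with
  | add p q hp hq => simp only [eval_add]; fun_prop
  | monomial n c =>
    simp only [eval_monomial]
    fun_prop

theorem integrable_exp_neg_groundExponent_mul (hω : ∀ j, 0 < ω j)
    {P : EuclideanSpace ℝ (Fin d) → ℂ} (hP : P.HasTemperateGrowth)
    (g : Lp ℂ 2 (volume : Measure (EuclideanSpace ℝ (Fin d)))) :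
    Integrable fun x => Real.exp (-groundExponent ω x) * P x * g x := by
  obtain ⟨c, hc, hqc⟩ := exists_mul_norm_sq_le_groundExponent hω
  have h := (SchwartzMap.expNegSMul (hasTemperateGrowth_groundExponent ω) hc hqc hP).memLp 2 volume
  refine (h.integrable_mul (Lp.memLp g)).congr (ae_of_all _ fun x => ?_)
  rfl

/-- Orthogonality to Hermite polynomials in one coordinate gives orthogonality to all polynomials
in that coordinate. -/
theorem integral_eval_coord_eq_zero (hω : ∀ j, 0 < ω j)
    (g : Lp ℂ 2 (volume : Measure (EuclideanSpace ℝ (Fin d))))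
    {R : EuclideanSpace ℝ (Fin d) → ℂ} (hR : R.HasTemperateGrowth) (a : ℝ) (j : Fin d)
    (h : ∀ n, ∫ x, Real.exp (-groundExponent ω x) *
      (((hermite n).map (Int.castRingHom ℂ)).eval ((a * x j : ℝ) : ℂ) * R x) * g x = 0)
    (p : ℂ[X]) :
    ∫ x, Real.exp (-groundExponent ω x) * (p.eval ((a * x j : ℝ) : ℂ) * R x) * g x = 0 := by
  have hp : p ∈ Submodule.span ℂ (Set.range fun n => (hermite n).map (Int.castRingHom ℂ)) := by
    rw [span_range_hermite]
    trivial
  have hi : ∀ q : ℂ[X], Integrable fun x => Real.exp (-groundExponent ω x) *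
      (q.eval ((a * x j : ℝ) : ℂ) * R x) * g x := fun q =>
    integrable_exp_neg_groundExponent_mul hω
      (P := fun x => q.eval ((a * x j : ℝ) : ℂ) * R x)
      ((hasTemperateGrowth_eval_coord q a j).mul hR) g
  induction hp using Submodule.span_induction with
  | mem q hq =>
    obtain ⟨n, rfl⟩ := hq
    exact h n
  | zero => simp
  | add q r _ _ hq hr =>
    have e : ∀ x, Real.exp (-groundExponent ω x) *
        ((q + r).eval ((a * x j : ℝ) : ℂ) * R x) * g x =
        Real.exp (-groundExponent ω x) * (q.eval ((a * x j : ℝ) : ℂ) * R x) * g x +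
        Real.exp (-groundExponent ω x) * (r.eval ((a * x j : ℝ) : ℂ) * R x) * g x := by
      intro x
      rw [eval_add]
      ring
    simp only [e]
    rw [integral_add (hi q) (hi r), hq, hr, add_zero]
  | smul c q _ hq =>
    have e : ∀ x, Real.exp (-groundExponent ω x) *
        ((c • q).eval ((a * x j : ℝ) : ℂ) * R x) * g x =
        c * (Real.exp (-groundExponent ω x) * (q.eval ((a * x j : ℝ) : ℂ) * R x) * g x) := by
      intro x
      rw [eval_smul, smul_eq_mul]
      ring
    simp only [e]
    rw [integral_const_mul, hq, mul_zero]

/-- Hermite polynomials are replaced by arbitrary ones a coordinate at a time; `s` is the set of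
coordinates already freed. -/
theorem integral_prod_eval_eq_zero_aux (hω : ∀ j, 0 < ω j)
    (g : Lp ℂ 2 (volume : Measure (EuclideanSpace ℝ (Fin d)))) (a : Fin d → ℝ)
    (h : ∀ k : Fin d → ℕ, ∫ x, Real.exp (-groundExponent ω x) *
      (∏ j, ((hermite (k j)).map (Int.castRingHom ℂ)).eval ((a j * x j : ℝ) : ℂ)) * g x = 0)
    (s : Finset (Fin d)) (p : Fin d → ℂ[X])
    (hp : ∀ j ∉ s, ∃ n, p j = (hermite n).map (Int.castRingHom ℂ)) :
    ∫ x, Real.exp (-groundExponent ω x) *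
      (∏ j, (p j).eval ((a j * x j : ℝ) : ℂ)) * g x = 0 := by
  classical
  induction s using Finset.induction_on generalizing p with
  | empty =>
    choose k hk using fun j => hp j (Finset.notMem_empty j)
    simp only [hk]
    exact h k
  | insert i s hi ih =>
    have e : ∀ (q : ℂ[X]) (x : EuclideanSpace ℝ (Fin d)),
        ∏ j, (Function.update p i q j).eval ((a j * x j : ℝ) : ℂ) =
        q.eval ((a i * x i : ℝ) : ℂ) *
          ∏ j ∈ Finset.univ.erase i, (p j).eval ((a j * x j : ℝ) : ℂ) := by
      intro q x
      rw [← Finset.mul_prod_erase _ _ (Finset.mem_univ i), Function.update_self]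
      congr 1
      refine Finset.prod_congr rfl fun j hj => ?_
      rw [Function.update_of_ne (Finset.ne_of_mem_erase hj)]
    have e' := e (p i)
    rw [Function.update_eq_self] at e'
    simp only [e']
    refine integral_eval_coord_eq_zero hω g
      (Function.HasTemperateGrowth.finset_prod_complex _ fun j =>
        hasTemperateGrowth_eval_coord (p j) (a j) j) (a i) i (fun n => ?_) (p i)
    rw [← ih (Function.update p i ((hermite n).map (Int.castRingHom ℂ)))]
    · simp only [e]
    · intro j hj
      by_cases hji : j = i
      · subst hji
        exact ⟨n, Function.update_self ..⟩
      · rw [Function.update_of_ne hji]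
        exact hp j (by simp [hji, hj])

theorem integral_prod_eval_eq_zero (hω : ∀ j, 0 < ω j)
    {g : Lp ℂ 2 (volume : Measure (EuclideanSpace ℝ (Fin d)))}
    (h : ∀ k, inner ℂ (oscillatorEigenvector hω k) g = 0) (p : Fin d → ℂ[X]) :
    ∫ x, Real.exp (-groundExponent ω x) *
      (∏ j, (p j).eval ((√2 * √(ω j) * x j : ℝ) : ℂ)) * g x = 0 := by
  refine integral_prod_eval_eq_zero_aux hω g (fun j => √2 * √(ω j)) (fun k => ?_) Finset.univ p
    (fun j hj => absurd (Finset.mem_univ j) hj)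
  set c : ℝ := ∏ j, ω j ^ (1 / 4 : ℝ) * (√(((k j).factorial : ℝ) * √Real.pi))⁻¹ with hc
  have hc0 : (c : ℂ) ≠ 0 := by
    rw [Complex.ofReal_ne_zero, hc]
    refine Finset.prod_ne_zero_iff.2 fun j _ => ?_
    have := Real.rpow_pos_of_pos (hω j) (1 / 4)
    have := Real.pi_pos
    positivity
  have e : inner ℂ (oscillatorEigenvector hω k) g =
      c * ∫ x, Real.exp (-groundExponent ω x) *
        (∏ j, ((hermite (k j)).map (Int.castRingHom ℂ)).eval ((√2 * √(ω j) * x j : ℝ) : ℂ)) *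
          g x := by
    rw [L2.inner_def, ← integral_const_mul]
    refine integral_congr_ae ?_
    filter_upwards [(memLp_oscillatorEigenfunction hω k).coeFn_toLp] with x hx
    change inner ℂ (((memLp_oscillatorEigenfunction hω k).toLp _ : _ → ℂ) x) (g x) = _
    rw [hx, RCLike.inner_apply, Complex.conj_ofReal, oscillatorEigenfunction_eq hω,
      oscillatorPolynomial]
    have e2 : ∀ j, ((aeval (√2 * (√(ω j) * x j)) (hermite (k j)) : ℝ) : ℂ) =
        ((hermite (k j)).map (Int.castRingHom ℂ)).eval ((√2 * √(ω j) * x j : ℝ) : ℂ) := by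
      intro j
      rw [eval_map, ← mul_assoc]
      have := Polynomial.aeval_algebraMap_apply ℂ (√2 * √(ω j) * x j) (hermite (k j))
      rw [Complex.coe_algebraMap] at this
      rw [← this]
      rfl
    simp only [← e2]
    rw [hc, ← Complex.ofReal_prod, ← Complex.ofReal_mul, mul_comm (g x), ← mul_assoc (c : ℂ),
      ← Complex.ofReal_mul]
    congr 2
    rw [mul_left_comm, ← Finset.prod_mul_distrib]
    simp only [mul_assoc]
  exact (mul_eq_zero.1 (e.symm.trans (h k))).resolve_left hc0

/-- The Taylor polynomial of `y ↦ e^{z y}`. -/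
noncomputable def expPolynomial (z : ℂ) (N : ℕ) : ℂ[X] :=
  ∑ n ∈ Finset.range N, monomial n (z ^ n / n.factorial)

theorem eval_expPolynomial (z y : ℂ) (N : ℕ) :
    (expPolynomial z N).eval y = ∑ n ∈ Finset.range N, (z * y) ^ n / n.factorial := by
  rw [expPolynomial, eval_finsetSum]
  refine Finset.sum_congr rfl fun n _ => ?_
  rw [eval_monomial]
  ring

theorem tendsto_eval_expPolynomial (z y : ℂ) :
    Filter.Tendsto (fun N => (expPolynomial z N).eval y) Filter.atTop
      (nhds (Complex.exp (z * y))) := by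
  simp only [eval_expPolynomial]
  rw [Complex.exp_eq_exp_ℂ]
  exact (NormedSpace.expSeries_div_hasSum_exp (z * y)).tendsto_sum_nat

theorem norm_eval_expPolynomial_le (z y : ℂ) (N : ℕ) :
    ‖(expPolynomial z N).eval y‖ ≤ Real.exp (‖z‖ * ‖y‖) := by
  rw [eval_expPolynomial]
  refine (norm_sum_le _ _).trans ?_
  refine le_trans (le_of_eq ?_) (Real.sum_le_exp_of_nonneg (x := ‖z‖ * ‖y‖) (by positivity) N)
  refine Finset.sum_congr rfl fun n _ => ?_
  rw [norm_div, norm_pow, norm_mul, Complex.norm_natCast]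

/-- Half of the Gaussian exponent absorbs the linear exponentials by completing the square; the
other half keeps the majorant integrable against `L²` functions. -/
theorem exp_neg_groundExponent_mul_prod_exp_le (hω : ∀ j, 0 < ω j) (b : Fin d → ℝ)
    (x : EuclideanSpace ℝ (Fin d)) :
    Real.exp (-groundExponent ω x) * ∏ j, Real.exp (b j * |x j|) ≤
      Real.exp (∑ j, b j ^ 2 / ω j) * Real.exp (-groundExponent (fun j => ω j / 2) x) := by
  rw [← Real.exp_sum, ← Real.exp_add, ← Real.exp_add, groundExponent, groundExponent]
  refine Real.exp_le_exp.2 ?_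
  rw [neg_add_eq_sub, ← sub_eq_add_neg, ← Finset.sum_sub_distrib, ← Finset.sum_sub_distrib]
  refine Finset.sum_le_sum fun j _ => ?_
  have hj := hω j
  have h : b j ^ 2 / ω j - ω j / 2 / 2 * x j ^ 2 - (b j * |x j| - ω j / 2 * x j ^ 2) =
      (ω j * |x j| / 2 - b j) ^ 2 / ω j := by
    rw [← sq_abs (x j)]
    field_simp
    ring
  have h2 : 0 ≤ (ω j * |x j| / 2 - b j) ^ 2 / ω j := by positivity
  linarith

/-- The character is a limit of products of Taylor polynomials, each of which integrates to zero;
dominated convergence passes to the limit. The factor `1` is the coefficient `P` of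
`integrable_exp_neg_groundExponent_mul`. -/
theorem fourier_exp_neg_groundExponent_mul_eq_zero (hω : ∀ j, 0 < ω j)
    {g : Lp ℂ 2 (volume : Measure (EuclideanSpace ℝ (Fin d)))}
    (h : ∀ k, inner ℂ (oscillatorEigenvector hω k) g = 0) (ξ : EuclideanSpace ℝ (Fin d)) :
    𝓕 (fun x => (Real.exp (-groundExponent ω x) : ℂ) * 1 * g x) ξ = 0 := by
  have ha : ∀ j, 0 < √2 * √(ω j) := fun j =>
    mul_pos (by positivity) (Real.sqrt_pos.2 (hω j))
  -- The division undoes the scaling of the variable at which the polynomials are evaluated.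
  set z : Fin d → ℂ := fun j => -2 * Real.pi * Complex.I * ξ j / (√2 * √(ω j) : ℝ) with hz
  have hzx : ∀ (x : EuclideanSpace ℝ (Fin d)) (j : Fin d),
      z j * ((√2 * √(ω j) * x j : ℝ) : ℂ) = -2 * Real.pi * Complex.I * ξ j * x j := by
    intro x j
    have h0 : ((√2 * √(ω j) : ℝ) : ℂ) ≠ 0 := Complex.ofReal_ne_zero.2 (ha j).ne'
    rw [hz, Complex.ofReal_mul (√2 * √(ω j))]
    field_simp
  set F : ℕ → EuclideanSpace ℝ (Fin d) → ℂ := fun N x => Real.exp (-groundExponent ω x) *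
    (∏ j, (expPolynomial (z j) N).eval ((√2 * √(ω j) * x j : ℝ) : ℂ)) * g x with hF
  have hint : ∀ N, Integrable (F N) := fun N =>
    integrable_exp_neg_groundExponent_mul hω
      (Function.HasTemperateGrowth.finset_prod_complex _ fun j =>
        hasTemperateGrowth_eval_coord (expPolynomial (z j) N) (√2 * √(ω j)) j) g
  set b : Fin d → ℝ := fun j => ‖z j‖ * (√2 * √(ω j)) with hb
  have hbd := ((integrable_exp_neg_groundExponent_mul (ω := fun j => ω j / 2)
    (fun j => half_pos (hω j)) (Function.HasTemperateGrowth.const (1 : ℂ)) g).norm).const_mul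
    (Real.exp (∑ j, b j ^ 2 / ω j))
  have hlim := tendsto_integral_of_dominated_convergence (F := F)
    (f := fun x => Complex.exp (((-2 * Real.pi * ⟪x, ξ⟫_ℝ : ℝ) : ℂ) * Complex.I) •
      ((Real.exp (-groundExponent ω x) : ℂ) * 1 * g x)) _
    (fun N => (hint N).aestronglyMeasurable) hbd (fun N => ae_of_all _ fun x => ?_)
    (ae_of_all _ fun x => ?_)
  · rw [Real.fourier_eq']
    refine tendsto_nhds_unique hlim ?_
    have h0 : ∀ N, ∫ x, F N x = 0 := fun N =>
      integral_prod_eval_eq_zero hω h fun j => expPolynomial (z j) N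
    simp only [h0]
    exact tendsto_const_nhds
  · simp only [hF, norm_mul, mul_one, Complex.norm_real, Real.norm_of_nonneg (Real.exp_pos _).le,
      norm_prod]
    rw [← mul_assoc]
    refine mul_le_mul_of_nonneg_right ?_ (norm_nonneg _)
    refine le_trans ?_ (exp_neg_groundExponent_mul_prod_exp_le hω b x)
    refine mul_le_mul_of_nonneg_left ?_ (Real.exp_pos _).le
    refine Finset.prod_le_prod (fun j _ => norm_nonneg _) fun j _ => ?_
    refine (norm_eval_expPolynomial_le _ _ _).trans (le_of_eq ?_)
    rw [Complex.norm_real, norm_mul, Real.norm_of_nonneg (ha j).le, Real.norm_eq_abs,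
      ← mul_assoc ‖z j‖]
  · have h1 : Complex.exp (((-2 * Real.pi * ⟪x, ξ⟫_ℝ : ℝ) : ℂ) * Complex.I) =
        ∏ j, Complex.exp (z j * ((√2 * √(ω j) * x j : ℝ) : ℂ)) := by
      rw [← Complex.exp_sum]
      congr 1
      simp only [hzx]
      rw [PiLp.inner_apply]
      simp only [RCLike.inner_apply, conj_trivial]
      push_cast
      rw [Finset.mul_sum, Finset.sum_mul]
      refine Finset.sum_congr rfl fun j _ => ?_
      ring
    rw [h1, smul_eq_mul, mul_one, ← mul_assoc, mul_comm (∏ j, _)]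
    exact ((tendsto_finsetProd _ fun j _ => tendsto_eval_expPolynomial _ _).const_mul _).mul_const _

theorem eq_zero_of_inner_oscillatorEigenvector_eq_zero (hω : ∀ j, 0 < ω j)
    {g : Lp ℂ 2 (volume : Measure (EuclideanSpace ℝ (Fin d)))}
    (h : ∀ k, inner ℂ (oscillatorEigenvector hω k) g = 0) : g = 0 := by
  rw [Lp.eq_zero_iff_ae_eq_zero]
  have hG := integrable_exp_neg_groundExponent_mul hω (Function.HasTemperateGrowth.const (1 : ℂ)) g
  filter_upwards [hG.ae_eq_zero_of_fourier_eq_zero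
    (fourier_exp_neg_groundExponent_mul_eq_zero hω h)] with x hx
  simpa using hx

/-- The eigenfunctions of the harmonic oscillator form a Hilbert basis of `L²`. -/
noncomputable def oscillatorBasis (hω : ∀ j, 0 < ω j) :
    HilbertBasis (Fin d → ℕ) ℂ (Lp ℂ 2 (volume : Measure (EuclideanSpace ℝ (Fin d)))) :=
  HilbertBasis.mkOfOrthogonalEqBot (orthonormal_oscillatorEigenvector hω) <| by
    rw [Submodule.eq_bot_iff]
    intro g hg
    refine eq_zero_of_inner_oscillatorEigenvector_eq_zero hω fun k => ?_
    exact (Submodule.mem_orthogonal _ _).1 hg _ (Submodule.subset_span ⟨k, rfl⟩)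

theorem oscillatorBasis_apply (hω : ∀ j, 0 < ω j) (k : Fin d → ℕ) :
    oscillatorBasis hω k = oscillatorEigenvector hω k := by
  rw [oscillatorBasis, HilbertBasis.coe_mkOfOrthogonalEqBot]

end Completeness

/-! ### The domain of the oscillator in terms of eigenfunction coefficients. -/

section Domain

open SchwartzMap Filter
open scoped Topology

variable {d : ℕ} {ω : Fin d → ℝ}

theorem harmonicOscillator_apply (ω : Fin d → ℝ) (T : 𝓢'(EuclideanSpace ℝ (Fin d), ℂ))
    (g : 𝓢(EuclideanSpace ℝ (Fin d), ℂ)) : harmonicOscillator ω T g = T (oscillator ω g) := by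
  rw [oscillator_eq, map_add, map_neg, ← TemperedDistribution.laplacian_apply_apply,
    ← TemperedDistribution.smulLeftCLM_apply_apply]
  rfl

theorem isHarmonicOscillatorValue_iff
    {u f : Lp ℂ 2 (volume : Measure (EuclideanSpace ℝ (Fin d)))} :
    IsHarmonicOscillatorValue ω u f ↔
      ∀ g : 𝓢(EuclideanSpace ℝ (Fin d), ℂ), ∫ x, oscillator ω g x * u x = ∫ x, g x * f x := by
  rw [IsHarmonicOscillatorValue, DFunLike.ext_iff]
  simp only [harmonicOscillator_apply, Lp.toTemperedDistribution_apply, smul_eq_mul]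

/-- `-Δ + Ω` is symmetric on Schwartz functions. -/
theorem integral_oscillator_mul (ω : Fin d → ℝ) (f g : 𝓢(EuclideanSpace ℝ (Fin d), ℂ)) :
    ∫ x, oscillator ω f x * g x = ∫ x, f x * oscillator ω g x := by
  have h := integral_mul_laplacian_right_eq_left (μ := volume) f g
  have e1 : ∀ x, oscillator ω f x * g x =
      pmul (smulLeftCLM ℂ (fun x => (trapPotential ω x : ℂ)) f) g x - pmul (Δ f) g x := by
    intro x
    rw [oscillator_eq, add_apply, neg_apply, pmul_apply, pmul_apply]
    ring
  have e2 : ∀ x, f x * oscillator ω g x =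
      pmul (smulLeftCLM ℂ (fun x => (trapPotential ω x : ℂ)) f) g x - pmul f (Δ g) x := by
    intro x
    rw [oscillator_eq, add_apply, neg_apply, pmul_apply, pmul_apply,
      smulLeftCLM_trapPotential_apply, smulLeftCLM_trapPotential_apply]
    ring
  simp only [e1, e2]
  rw [integral_sub (SchwartzMap.integrable _) (SchwartzMap.integrable _),
    integral_sub (SchwartzMap.integrable _) (SchwartzMap.integrable _)]
  congr 1
  exact h.symm

theorem isHarmonicOscillatorValue_toL2 (ω : Fin d → ℝ) (f : 𝓢(EuclideanSpace ℝ (Fin d), ℂ)) :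
    IsHarmonicOscillatorValue ω (toL2 f) (toL2 (oscillator ω f)) := by
  rw [isHarmonicOscillatorValue_iff]
  intro g
  have h1 : ∫ x, oscillator ω g x * toL2 f x = ∫ x, oscillator ω g x * f x := by
    refine integral_congr_ae ?_
    filter_upwards [coeFn_toL2 f] with x hx
    rw [hx]
  have h2 : ∫ x, g x * toL2 (oscillator ω f) x = ∫ x, g x * oscillator ω f x := by
    refine integral_congr_ae ?_
    filter_upwards [coeFn_toL2 (oscillator ω f)] with x hx
    rw [hx]
  rw [h1, h2, integral_oscillator_mul]

/-- Translates between the bilinear pairing of distributions and the sesquilinear inner product. -/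
theorem inner_toL2_left (g : 𝓢(EuclideanSpace ℝ (Fin d), ℂ))
    (u : Lp ℂ 2 (volume : Measure (EuclideanSpace ℝ (Fin d)))) :
    inner ℂ (toL2 g) u = ∫ x, SchwartzMap.conj g x * u x := by
  rw [L2.inner_def]
  refine integral_congr_ae ?_
  filter_upwards [coeFn_toL2 g] with x hx
  rw [hx, RCLike.inner_apply, conj_apply, mul_comm]

theorem inner_oscillatorEigenvector (hω : ∀ j, 0 < ω j) (k : Fin d → ℕ)
    (u : Lp ℂ 2 (volume : Measure (EuclideanSpace ℝ (Fin d)))) :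
    inner ℂ (oscillatorEigenvector hω k) u = ∫ x, oscillatorEigenSchwartz hω k x * u x := by
  rw [← toL2_oscillatorEigenSchwartz, inner_toL2_left]
  simp only [conj_apply, oscillatorEigenSchwartz_apply, Complex.conj_ofReal]

/-- The eigenfunctions are real Schwartz functions, hence admissible test functions for `Au = f`. -/
theorem IsHarmonicOscillatorValue.inner_eq (hω : ∀ j, 0 < ω j)
    {u f : Lp ℂ 2 (volume : Measure (EuclideanSpace ℝ (Fin d)))}
    (h : IsHarmonicOscillatorValue ω u f) (k : Fin d → ℕ) :
    inner ℂ (oscillatorEigenvector hω k) f =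
      oscillatorEigenvalue ω k * inner ℂ (oscillatorEigenvector hω k) u := by
  rw [inner_oscillatorEigenvector, inner_oscillatorEigenvector, ← integral_const_mul,
    ← isHarmonicOscillatorValue_iff.1 h, oscillator_oscillatorEigenSchwartz]
  simp only [smul_apply, smul_eq_mul, mul_assoc]

theorem conj_conj_schwartz (g : 𝓢(EuclideanSpace ℝ (Fin d), ℂ)) :
    SchwartzMap.conj (SchwartzMap.conj g) = g := by
  ext x
  simp

theorem conj_oscillator (ω : Fin d → ℝ) (g : 𝓢(EuclideanSpace ℝ (Fin d), ℂ)) :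
    SchwartzMap.conj (oscillator ω g) = oscillator ω (SchwartzMap.conj g) := by
  rw [oscillator_eq, oscillator_eq, SchwartzMap.laplacian_eq_sum (EuclideanSpace.basisFun (Fin d) ℝ),
    SchwartzMap.laplacian_eq_sum (EuclideanSpace.basisFun (Fin d) ℝ)]
  simp only [lineDerivOp_conj]
  ext x
  simp only [conj_apply, add_apply, neg_apply, sum_apply, smulLeftCLM_trapPotential_apply, map_add,
    map_neg, map_sum, map_mul, Complex.conj_ofReal]

/-- `Au = f` holds if and only if it holds for the expansions in eigenfunctions. -/
theorem isHarmonicOscillatorValue_iff_inner (hω : ∀ j, 0 < ω j)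
    {u f : Lp ℂ 2 (volume : Measure (EuclideanSpace ℝ (Fin d)))} :
    IsHarmonicOscillatorValue ω u f ↔ ∀ k, inner ℂ (oscillatorEigenvector hω k) f =
      oscillatorEigenvalue ω k * inner ℂ (oscillatorEigenvector hω k) u := by
  refine ⟨fun h => h.inner_eq hω, fun h => isHarmonicOscillatorValue_iff.2 fun g => ?_⟩
  have e1 : ∫ x, oscillator ω g x * u x =
      inner ℂ (toL2 (oscillator ω (SchwartzMap.conj g))) u := by
    rw [inner_toL2_left, conj_oscillator, conj_conj_schwartz]
  have e2 : ∫ x, g x * f x = inner ℂ (toL2 (SchwartzMap.conj g)) f := by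
    rw [inner_toL2_left, conj_conj_schwartz]
  -- By Parseval both sides are sums over `k`; the real eigenvalue moves from the coefficient of the
  -- test function to that of `u`.
  rw [e1, e2, ← (oscillatorBasis hω).tsum_inner_mul_inner,
    ← (oscillatorBasis hω).tsum_inner_mul_inner]
  refine tsum_congr fun k => ?_
  have h2 := (isHarmonicOscillatorValue_toL2 ω (SchwartzMap.conj g)).inner_eq hω k
  rw [oscillatorBasis_apply, h k, ← inner_conj_symm _ (oscillatorEigenvector hω k), h2,
    ← inner_conj_symm _ (oscillatorEigenvector hω k), map_mul, Complex.conj_ofReal]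
  ring

theorem hasSum_norm_inner_oscillatorEigenvector_sq (hω : ∀ j, 0 < ω j)
    (f : Lp ℂ 2 (volume : Measure (EuclideanSpace ℝ (Fin d)))) :
    HasSum (fun k => ‖inner ℂ (oscillatorEigenvector hω k) f‖ ^ 2) (‖f‖ ^ 2) := by
  have h := ((oscillatorBasis hω).hasSum_inner_mul_inner f f).mapL Complex.reCLM
  have e : ∀ k, Complex.reCLM (inner ℂ f (oscillatorBasis hω k) * inner ℂ (oscillatorBasis hω k) f) =
      ‖inner ℂ (oscillatorEigenvector hω k) f‖ ^ 2 := by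
    intro k
    rw [oscillatorBasis_apply, ← inner_conj_symm f, ← Complex.normSq_eq_conj_mul_self,
      Complex.normSq_eq_norm_sq]
    exact Complex.ofReal_re _
  have e' : Complex.reCLM (inner ℂ f f) = ‖f‖ ^ 2 := (norm_sq_eq_re_inner (𝕜 := ℂ) f).symm
  rw [e'] at h
  simpa only [e] using h

theorem IsHarmonicOscillatorValue.hermiteSobolevTerm_eq (hω : ∀ j, 0 < ω j)
    {u f : Lp ℂ 2 (volume : Measure (EuclideanSpace ℝ (Fin d)))}
    (h : IsHarmonicOscillatorValue ω u f) (k : Fin d → ℕ) :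
    hermiteSobolevTerm hω 2 u k = ‖inner ℂ (oscillatorEigenvector hω k) f‖ ^ 2 := by
  rw [h.inner_eq hω, norm_mul, mul_pow, Complex.norm_real, Real.norm_eq_abs, sq_abs,
    hermiteSobolevTerm, Real.rpow_two]

theorem mem_hermiteSobolev_two_iff (hω : ∀ j, 0 < ω j)
    (u : Lp ℂ 2 (volume : Measure (EuclideanSpace ℝ (Fin d)))) :
    u ∈ hermiteSobolev hω 2 ↔ ∃ f, IsHarmonicOscillatorValue ω u f := by
  constructor
  · intro hu
    have hu' : Summable (hermiteSobolevTerm hω 2 u) := hu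
    -- These are the coefficients that `Au` must have; being square-summable, they belong to an
    -- element of `L²`.
    have hm : Memℓp (fun k => (oscillatorEigenvalue ω k : ℂ) *
        inner ℂ (oscillatorEigenvector hω k) u) 2 := by
      rw [memℓp_gen_iff (by norm_num)]
      refine hu'.congr fun k => ?_
      rw [hermiteSobolevTerm, norm_mul, Complex.norm_real, Real.norm_eq_abs, ENNReal.toReal_ofNat,
        Real.rpow_two, Real.rpow_two, mul_pow, sq_abs]
    refine ⟨(oscillatorBasis hω).repr.symm ⟨_, hm⟩, (isHarmonicOscillatorValue_iff_inner hω).2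
      fun k => ?_⟩
    conv_lhs => rw [← oscillatorBasis_apply, ← HilbertBasis.repr_apply_apply,
      LinearIsometryEquiv.apply_symm_apply]
  · rintro ⟨f, hf⟩
    exact ((hasSum_norm_inner_oscillatorEigenvector_sq hω f).summable).congr fun k =>
      (hf.hermiteSobolevTerm_eq hω k).symm

theorem IsHarmonicOscillatorValue.hermiteSobolevNorm_eq (hω : ∀ j, 0 < ω j)
    {u f : Lp ℂ 2 (volume : Measure (EuclideanSpace ℝ (Fin d)))}
    (h : IsHarmonicOscillatorValue ω u f) : hermiteSobolevNorm hω 2 u = ‖f‖ := by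
  rw [hermiteSobolevNorm, tsum_congr (h.hermiteSobolevTerm_eq hω),
    (hasSum_norm_inner_oscillatorEigenvector_sq hω f).tsum_eq, Real.sqrt_sq (norm_nonneg _)]

/-- The lowest eigenvalue bounds `-Δ + Ω` from below. -/
theorem IsHarmonicOscillatorValue.norm_le (hω : ∀ j, 0 < ω j) (hd : 1 ≤ d)
    {u f : Lp ℂ 2 (volume : Measure (EuclideanSpace ℝ (Fin d)))}
    (h : IsHarmonicOscillatorValue ω u f) : ‖u‖ ≤ (∑ j, ω j)⁻¹ * ‖f‖ := by
  -- In dimension zero the lowest eigenvalue `∑ⱼ ωⱼ` would be `0`.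
  have hne : (Finset.univ : Finset (Fin d)).Nonempty := ⟨⟨0, hd⟩, Finset.mem_univ _⟩
  have hm : 0 < ∑ j, ω j := Finset.sum_pos (fun j _ => hω j) hne
  have hk : ∀ k, ∑ j, ω j ≤ oscillatorEigenvalue ω k := fun k =>
    Finset.sum_le_sum fun j _ => by
      have := mul_nonneg (hω j).le (k j).cast_nonneg (α := ℝ)
      linarith
  rw [inv_mul_eq_div, le_div_iff₀ hm]
  refine (pow_le_pow_iff_left₀ (by positivity) (norm_nonneg _) two_ne_zero).1 ?_
  rw [mul_pow]
  refine hasSum_le (fun k => ?_)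
    ((hasSum_norm_inner_oscillatorEigenvector_sq hω u).mul_right ((∑ j, ω j) ^ 2))
    (hasSum_norm_inner_oscillatorEigenvector_sq hω f)
  rw [h.inner_eq hω, norm_mul, mul_pow, Complex.norm_real, Real.norm_eq_abs, sq_abs, mul_comm]
  exact mul_le_mul_of_nonneg_right (pow_le_pow_left₀ hm.le (hk k) 2) (sq_nonneg _)

/-- Schwartz functions are a core of the harmonic oscillator. -/
theorem IsHarmonicOscillatorValue.exists_seq_schwartz (hω : ∀ j, 0 < ω j)
    {u f : Lp ℂ 2 (volume : Measure (EuclideanSpace ℝ (Fin d)))}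
    (h : IsHarmonicOscillatorValue ω u f) :
    ∃ p : ℕ → 𝓢(EuclideanSpace ℝ (Fin d), ℂ), Tendsto (fun n => toL2 (p n)) atTop (𝓝 u) ∧
      Tendsto (fun n => toL2 (oscillator ω (p n))) atTop (𝓝 f) := by
  set b := oscillatorBasis hω
  -- Partial sums of the expansion of `u`; `A` maps them to the partial sums of the expansion of
  -- `f`.
  set P : Finset (Fin d → ℕ) → 𝓢(EuclideanSpace ℝ (Fin d), ℂ) := fun s =>
    ∑ k ∈ s, inner ℂ (oscillatorEigenvector hω k) u • oscillatorEigenSchwartz hω k with hP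
  have h1 : Tendsto (fun s => toL2 (P s)) atTop (𝓝 u) := by
    refine (b.hasSum_repr u).congr fun s => ?_
    simp only [hP, map_sum, map_smul, toL2_oscillatorEigenSchwartz]
    refine Finset.sum_congr rfl fun k _ => ?_
    rw [HilbertBasis.repr_apply_apply, oscillatorBasis_apply]
  have h2 : Tendsto (fun s => toL2 (oscillator ω (P s))) atTop (𝓝 f) := by
    refine (b.hasSum_repr f).congr fun s => ?_
    simp only [hP, map_sum, map_smul, oscillator_oscillatorEigenSchwartz,
      toL2_oscillatorEigenSchwartz]
    refine Finset.sum_congr rfl fun k _ => ?_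
    rw [HilbertBasis.repr_apply_apply, oscillatorBasis_apply, h.inner_eq hω, smul_smul, mul_comm]
  obtain ⟨s, hs⟩ := exists_seq_tendsto (atTop : Filter (Finset (Fin d → ℕ)))
  exact ⟨fun n => P (s n), h1.comp hs, h2.comp hs⟩

end Domain

/-! ### Passage from Schwartz functions to the whole domain. -/

section Algebra

open SchwartzMap Filter
open scoped Topology

variable {d : ℕ} {ω : Fin d → ℝ}

/-- `L²` convergence gives almost everywhere convergence along a subsequence; three nested
extractions give one that serves all three limits. -/
theorem ae_eq_mul_of_tendsto_toL2 {p q : ℕ → 𝓢(EuclideanSpace ℝ (Fin d), ℂ)}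
    {u v w : Lp ℂ 2 (volume : Measure (EuclideanSpace ℝ (Fin d)))}
    (hp : Tendsto (fun n => toL2 (p n)) atTop (𝓝 u))
    (hq : Tendsto (fun n => toL2 (q n)) atTop (𝓝 v))
    (hw : Tendsto (fun n => toL2 (pmul (p n) (q n))) atTop (𝓝 w)) :
    ∀ᵐ x, w x = u x * v x := by
  obtain ⟨a, ha, hpa⟩ := (tendstoInMeasure_of_tendsto_Lp hp).exists_seq_tendsto_ae
  obtain ⟨b, hb, hqb⟩ :=
    (tendstoInMeasure_of_tendsto_Lp (hq.comp ha.tendsto_atTop)).exists_seq_tendsto_ae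
  obtain ⟨c, hc, hwc⟩ := (tendstoInMeasure_of_tendsto_Lp
    (hw.comp (ha.comp hb).tendsto_atTop)).exists_seq_tendsto_ae
  have e1 : ∀ᵐ x, ∀ n, toL2 (p n) x = p n x := ae_all_iff.2 fun n => coeFn_toL2 (p n)
  have e2 : ∀ᵐ x, ∀ n, toL2 (q n) x = q n x := ae_all_iff.2 fun n => coeFn_toL2 (q n)
  have e3 : ∀ᵐ x, ∀ n, toL2 (pmul (p n) (q n)) x = pmul (p n) (q n) x :=
    ae_all_iff.2 fun n => coeFn_toL2 _
  filter_upwards [hpa, hqb, hwc, e1, e2, e3] with x h1 h2 h3 e1 e2 e3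
  have h1' := h1.comp (hb.comp hc).tendsto_atTop
  have h2' := h2.comp hc.tendsto_atTop
  refine tendsto_nhds_unique h3 ((h1'.mul h2').congr fun n => ?_)
  simp only [Function.comp_apply, e1, e2, e3, pmul_apply]

theorem pmul_sub_pmul (p q p' q' : 𝓢(EuclideanSpace ℝ (Fin d), ℂ)) :
    pmul p q - pmul p' q' = pmul (p - p') q + pmul p' (q - q') := by
  ext x
  simp only [sub_apply, add_apply, pmul_apply]
  ring

/-- Products of elements of the domain of the oscillator lie in the domain. -/
theorem exists_isHarmonicOscillatorValue_mul (hω : ∀ j, 0 < ω j) (hd : 1 ≤ d) {C : ℝ}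
    (hA : ∀ f g : 𝓢(EuclideanSpace ℝ (Fin d), ℂ), ‖toL2 (oscillator ω (pmul f g))‖ ≤
      C * ‖toL2 (oscillator ω f)‖ * ‖toL2 (oscillator ω g)‖)
    {u v f g : Lp ℂ 2 (volume : Measure (EuclideanSpace ℝ (Fin d)))}
    (hu : IsHarmonicOscillatorValue ω u f) (hv : IsHarmonicOscillatorValue ω v g) :
    ∃ w h, IsHarmonicOscillatorValue ω w h ∧ (∀ᵐ x, w x = u x * v x) ∧
      ‖h‖ ≤ C * ‖f‖ * ‖g‖ := by
  obtain ⟨p, hpu, hpf⟩ := hu.exists_seq_schwartz hω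
  obtain ⟨q, hqv, hqg⟩ := hv.exists_seq_schwartz hω
  set W : ℕ → 𝓢(EuclideanSpace ℝ (Fin d), ℂ) := fun n => pmul (p n) (q n) with hW
  have hdiff : ∀ x : ℕ × ℕ, dist (toL2 (oscillator ω (W x.1))) (toL2 (oscillator ω (W x.2))) ≤
      C * dist (toL2 (oscillator ω (p x.1))) (toL2 (oscillator ω (p x.2))) *
        ‖toL2 (oscillator ω (q x.1))‖ + C * ‖toL2 (oscillator ω (p x.2))‖ *
        dist (toL2 (oscillator ω (q x.1))) (toL2 (oscillator ω (q x.2))) := by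
    intro x
    simp only [dist_eq_norm, ← map_sub, hW, pmul_sub_pmul, map_add]
    exact (norm_add_le _ _).trans (add_le_add (hA _ _) (hA _ _))
  have hcau : CauchySeq fun n => toL2 (oscillator ω (W n)) := by
    rw [cauchySeq_iff_tendsto_dist_atTop_0]
    refine squeeze_zero (fun _ => dist_nonneg) hdiff ?_
    have t1 := cauchySeq_iff_tendsto_dist_atTop_0.1 hpf.cauchySeq
    have t2 := cauchySeq_iff_tendsto_dist_atTop_0.1 hqg.cauchySeq
    have t3 : Tendsto (fun x : ℕ × ℕ => ‖toL2 (oscillator ω (q x.1))‖) atTop (𝓝 ‖g‖) := by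
      rw [← prod_atTop_atTop_eq]
      exact hqg.norm.comp tendsto_fst
    have t4 : Tendsto (fun x : ℕ × ℕ => ‖toL2 (oscillator ω (p x.2))‖) atTop (𝓝 ‖f‖) := by
      rw [← prod_atTop_atTop_eq]
      exact hpf.norm.comp tendsto_snd
    simpa using ((t1.const_mul C).mul t3).add ((t4.const_mul C).mul t2)
  -- The lower bound on `A`, applied to differences, carries the Cauchy property from `A W n` to `W
  -- n`.
  have hcau2 : CauchySeq fun n => toL2 (W n) := by
    rw [cauchySeq_iff_tendsto_dist_atTop_0] at hcau ⊢
    have t := hcau.const_mul (∑ j, ω j)⁻¹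
    rw [mul_zero] at t
    refine squeeze_zero (fun _ => dist_nonneg) (fun x => ?_) t
    rw [dist_eq_norm, dist_eq_norm, ← map_sub, ← map_sub, ← map_sub]
    exact (isHarmonicOscillatorValue_toL2 ω _).norm_le hω hd
  obtain ⟨h, hh⟩ := cauchySeq_tendsto_of_complete hcau
  obtain ⟨w, hw⟩ := cauchySeq_tendsto_of_complete hcau2
  -- `A` is closed: the coefficient relation survives `L²` limits on both sides.
  refine ⟨w, h, (isHarmonicOscillatorValue_iff_inner hω).2 fun k => ?_,
    ae_eq_mul_of_tendsto_toL2 hpu hqv hw, ?_⟩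
  · have l1 := (tendsto_const_nhds (x := oscillatorEigenvector hω k)).inner (𝕜 := ℂ) hh
    have l2 := ((tendsto_const_nhds (x := oscillatorEigenvector hω k)).inner (𝕜 := ℂ) hw).const_mul
      (oscillatorEigenvalue ω k : ℂ)
    refine tendsto_nhds_unique l1 (l2.congr fun n => ?_)
    exact ((isHarmonicOscillatorValue_toL2 ω (W n)).inner_eq hω k).symm
  · exact le_of_tendsto_of_tendsto' hh.norm ((hpf.norm.const_mul C).mul hqg.norm)
      fun n => hA (p n) (q n)

end Algebra

theorem mainTheorem9 (d : ℕ) (hd1 : 1 ≤ d) (hd3 : d ≤ 3) (ω : Fin d → ℝ)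
    (hω : ∀ j, 0 < ω j) :
    -- `H̃²` is the domain of `A = -Δ + Ω`, and its norm is `‖Au‖`
    (∀ u : Lp ℂ 2 (volume : Measure (EuclideanSpace ℝ (Fin d))),
      u ∈ hermiteSobolev hω 2 ↔ ∃ f, IsHarmonicOscillatorValue ω u f) ∧
    (∀ u f : Lp ℂ 2 (volume : Measure (EuclideanSpace ℝ (Fin d))),
      IsHarmonicOscillatorValue ω u f → hermiteSobolevNorm hω 2 u = ‖f‖) ∧
    -- `H̃²` is an algebra with the pointwise product
    ∃ C : ℝ, 0 < C ∧ ∀ u ∈ hermiteSobolev hω 2, ∀ v ∈ hermiteSobolev hω 2,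
      ∃ w ∈ hermiteSobolev hω 2, (∀ᵐ x, w x = u x * v x) ∧
        hermiteSobolevNorm hω 2 w ≤
          C * hermiteSobolevNorm hω 2 u * hermiteSobolevNorm hω 2 v := by
  have hc0 : 0 ≤ (∑ j, ω j)⁻¹ := inv_nonneg.2 (Finset.sum_nonneg fun j _ => (hω j).le)
  obtain ⟨C, hC, hA⟩ := SchwartzMap.exists_norm_toL2_oscillator_pmul_le hd3 ω hc0 fun f =>
    (isHarmonicOscillatorValue_toL2 ω f).norm_le hω hd1
  refine ⟨mem_hermiteSobolev_two_iff hω, fun u f h => h.hermiteSobolevNorm_eq hω, C, hC,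
    fun u hu v hv => ?_⟩
  obtain ⟨f, hf⟩ := (mem_hermiteSobolev_two_iff hω u).1 hu
  obtain ⟨g, hg⟩ := (mem_hermiteSobolev_two_iff hω v).1 hv
  obtain ⟨w, h, hw, hmul, hle⟩ := exists_isHarmonicOscillatorValue_mul hω hd1 hA hf hg
  refine ⟨w, (mem_hermiteSobolev_two_iff hω w).2 ⟨h, hw⟩, hmul, ?_⟩
  rw [hw.hermiteSobolevNorm_eq hω, hf.hermiteSobolevNorm_eq hω, hg.hermiteSobolevNorm_eq hω]
  exact hle
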